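/- Let $R$ be a finite commutative chain ring (a nonzero ring whose ideals are totally ordered by inclusion) with residue field $\mathbb F_q$, and let $S$ be a Galois extension of $R$ of degree $2$, i.e. $S\cong R[x]/(f)$ as an $R$-algebra, where $f$ is a monic polynomial of degree $2$ whose reduction over $\mathbb F_q$ is irreducible. Assume that $S$ is also a chain ring, with residue field $\mathbb F=\mathbb F_{q^2}$, and let $\sigma$ be an $R$-automorphism of $S$ of order $2$. For a finite abelian group $G$ of order $n$, a $2$-quasi-abelian code over $S$ is an $SG$-submodule $C$ of $(SG)^2$. Its length is $2n$, its rate is $\operatorname{rank}_S(C)/(2n)$, and its relative minimum distance is the minimum Hamming weight of a nonzero element of $C$ (as a word of length $2n$ over $S$) divided by $2n$. It is Hermitian LCD if $C\cap C^{\perp_H}=\{0\}$, where $C^{\perp_H}$ is the set of $x\in(SG)^2$ with $\langle x,c\rangle_H=0$ for all $c\in C$, and $\langle (a,a'),(b,b')\rangle_H=\sum_{g\in G}\bigl(a_g\sigma(b_g)+a'_g\sigma(b'_g)\bigr)$. A sequence of codes is asymptotically good if the lengths tend to infinity and both the rates and the relative minimum distances are bounded below by positive constants. Let $n_1,n_2,\ldots$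 be odd integers greater than $1$ and coprime to $q$, and let $G_i$ be an abelian group of order $n_i$ for $i=1,2,\ldots$. Let $\mu_q(n_i)$ be the minimum of $\dim_{\mathbb F}\mathbb FG_ie$ over all primitive idempotents $e$ of $\mathbb FG_i$ other than $e_0=\frac1{n_i}\sum_{g\in G_i}g$, and assume that $$\lim_{i\to\infty}\frac{\log_q n_i}{\mu_q(n_i)}=0 .$$ Then there exist Hermitian LCD $2$-quasi-abelian codes $\mathfrak C_i\subseteq (SG_i)^2$, $i=1,2,\ldots$, free over $S$ and of rate exactly $\tfrac12$, such that the sequence $\mathfrak C_1,\mathfrak C_2,\ldots$ is asymptotically good; in particular there is $\delta>0$ such that the relative minimum distance of $\mathfrak C_i$ exceeds $\delta$ for all $i$. -/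

import Mathlib

open Filter Topology

noncomputable section

/-- A commutative chain ring: a nonzero ring whose ideals are totally ordered by inclusion. -/
def IsCommChainRing (A : Type*) [CommRing A] : Prop :=
  Nontrivial A ∧ ∀ I J : Ideal A, I ≤ J ∨ J ≤ I

/-- `S` is a Galois extension of degree `m` of the local ring `R`: it is isomorphic, as an
`R`-algebra, to `R[x]/(f)` with `f` a monic basic irreducible polynomial of degree `m`, i.e. the
reduction of `f` over the residue field of `R` is irreducible. -/
def IsChainGaloisExtension (m : ℕ) (R S : Type*) [CommRing R] [IsLocalRing R] [CommRing S]
    [Algebra R S] : Prop :=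
  ∃ f : Polynomial R, f.Monic ∧ f.natDegree = m ∧
    Irreducible (f.map (IsLocalRing.residue R)) ∧ Nonempty (S ≃ₐ[R] AdjoinRoot f)

/-- An idempotent `e ≠ 0` of a commutative ring is primitive if the only idempotents `f` with
`f * e = f` are `0` and `e`. -/
def IsPrimitiveIdempotent {A : Type*} [CommRing A] (e : A) : Prop :=
  IsIdempotentElem e ∧ e ≠ 0 ∧ ∀ f : A, IsIdempotentElem f → f * e = f → f = 0 ∨ f = e

/-- The trivial idempotent `e₀ = |G|⁻¹ ∑_{g ∈ G} g` of the group algebra `FG`. -/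
def trivialIdempotent (F G : Type*) [Field F] [CommGroup G] [Fintype G] : MonoidAlgebra F G :=
  ∑ g : G, MonoidAlgebra.single g ((Fintype.card G : F)⁻¹)

/-- The minimum of `dim_F (FG e)` over all primitive idempotents `e ≠ e₀` of `FG`. -/
def minIdempotentDim (F G : Type*) [Field F] [CommGroup G] [Fintype G] : ℕ :=
  sInf {d : ℕ | ∃ e : MonoidAlgebra F G, IsPrimitiveIdempotent e ∧ e ≠ trivialIdempotent F G ∧
    d = Module.finrank F (Ideal.span {e} : Ideal (MonoidAlgebra F G))}

/-- A `2`-quasi-abelian code over `S`: an `SG`-submodule of `(SG)²`. -/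
abbrev TwoQuasiAbelianCode (S G : Type*) [CommRing S] [CommGroup G] :=
  Submodule (MonoidAlgebra S G) (MonoidAlgebra S G × MonoidAlgebra S G)

section Hermitian

variable {R S G : Type*} [CommRing R] [CommRing S] [Algebra R S] [CommGroup G] [Fintype G]

/-- The Hermitian inner product `∑_g a_g σ(b_g)` on `SG`. -/
def hermitianInner (σ : S ≃ₐ[R] S) (a b : MonoidAlgebra S G) : S :=
  ∑ g : G, a.coeff g * σ (b.coeff g)

/-- The Hermitian inner product on `(SG)²`. -/
def hermitianInnerPair (σ : S ≃ₐ[R] S) (x y : MonoidAlgebra S G × MonoidAlgebra S G) : S :=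
  hermitianInner σ x.1 y.1 + hermitianInner σ x.2 y.2

/-- The Hermitian dual of a code in `(SG)²`. -/
def hermitianDual (σ : S ≃ₐ[R] S) (C : TwoQuasiAbelianCode S G) :
    Set (MonoidAlgebra S G × MonoidAlgebra S G) :=
  {x | ∀ c ∈ C, hermitianInnerPair σ x c = 0}

/-- A code is Hermitian LCD if it meets its Hermitian dual only in `0`. -/
def IsHermitianLCD (σ : S ≃ₐ[R] S) (C : TwoQuasiAbelianCode S G) : Prop :=
  (C : Set (MonoidAlgebra S G × MonoidAlgebra S G)) ∩ hermitianDual σ C = {0}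

end Hermitian

section Parameters

variable {S G : Type*} [CommRing S] [CommGroup G] [Fintype G]

/-- The Hamming weight of a pair `(a, b)`, seen as a word of length `2|G|` over `S`. -/
def pairWeight (x : MonoidAlgebra S G × MonoidAlgebra S G) : ℕ :=
  x.1.coeff.support.card + x.2.coeff.support.card

/-- The minimum Hamming weight of the nonzero codewords (`0` for the zero code). -/
def minWeight (C : TwoQuasiAbelianCode S G) : ℕ :=
  sInf {w : ℕ | ∃ x ∈ C, x ≠ 0 ∧ w = pairWeight x}

/-- The length `2|G|` of a `2`-quasi-abelian code. -/
def codeLength (_C : TwoQuasiAbelianCode S G) : ℕ := 2 * Fintype.card G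

/-- The rate: the rank over `S` divided by the length. -/
def codeRate (C : TwoQuasiAbelianCode S G) : ℝ :=
  (Module.finrank S C : ℝ) / codeLength C

/-- The relative minimum distance: the minimum weight divided by the length. -/
def relMinDist (C : TwoQuasiAbelianCode S G) : ℝ :=
  (minWeight C : ℝ) / codeLength C

end Parameters

/-- A sequence of codes is asymptotically good if the lengths tend to infinity and both the rates
and the relative minimum distances are bounded below by positive constants. -/
def IsAsymptoticallyGood {S : Type*} [CommRing S] {G : ℕ → Type*} [∀ i, CommGroup (G i)]
    [∀ i, Fintype (G i)] (C : ∀ i, TwoQuasiAbelianCode S (G i)) : Prop :=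
  Tendsto (fun i => codeLength (C i)) atTop atTop ∧
    (∃ r : ℝ, 0 < r ∧ ∀ i, r ≤ codeRate (C i)) ∧
    (∃ δ : ℝ, 0 < δ ∧ ∀ i, δ < relMinDist (C i))

end

/-! ### Counting by cosets -/

section Counting

/-- If every coset of `T` meets `X` in at most `k` points, then `|X| |T| ≤ k |A|`. -/
theorem card_mul_natCard_le {A : Type*} [AddCommGroup A] [Fintype A] [DecidableEq A]
    (X : Finset A) (T : AddSubgroup A) [DecidablePred (· ∈ T)] (k : ℕ)
    (h : ∀ b ∈ X, (X.filter (fun x => x - b ∈ T)).card ≤ k) :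
    X.card * Nat.card T ≤ k * Fintype.card A := by
  have hT : ∀ b : A, (Finset.univ.filter (fun z => z - b ∈ T)).card = Nat.card T := by
    intro b
    rw [Nat.card_eq_fintype_card, ← Finset.card_univ]
    symm
    refine Finset.card_bij (fun t _ => (t : A) + b) ?_ ?_ ?_
    · intro t _; simp
    · intro t _ t' _ h; simpa using h
    · intro z hz
      exact ⟨⟨z - b, by simpa using hz⟩, Finset.mem_univ _, by simp⟩
  have hz : ∀ z : A, (X.filter (fun b => z - b ∈ T)).card ≤ k := by
    intro z
    rcases (X.filter (fun b => z - b ∈ T)).eq_empty_or_nonempty with h0 | ⟨b, hb⟩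
    · simp [h0]
    · rw [Finset.mem_filter] at hb
      refine le_trans (Finset.card_le_card ?_) (h b hb.1)
      intro x hx
      rw [Finset.mem_filter] at hx ⊢
      refine ⟨hx.1, ?_⟩
      have := T.sub_mem hb.2 hx.2
      simpa using this
  calc X.card * Nat.card T = ∑ b ∈ X, (Finset.univ.filter (fun z => z - b ∈ T)).card := by
        simp [hT]
    _ = ∑ z : A, (X.filter (fun b => z - b ∈ T)).card :=
        Finset.sum_card_bipartiteAbove_eq_sum_card_bipartiteBelow (fun b z => z - b ∈ T)
    _ ≤ ∑ _z : A, k := Finset.sum_le_sum fun z _ => hz z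
    _ = k * Fintype.card A := by simp [mul_comm]

end Counting

/-! ### Finite reduced rings as products of fields -/

section FieldBlocks

/-- A complete family of orthogonal idempotents cutting a commutative ring into fields. -/
structure IsFieldBlocks {A ι : Type*} [CommRing A] [Fintype ι] (e : ι → A) : Prop where
  complete : CompleteOrthogonalIdempotents e
  ne_zero : ∀ i, e i ≠ 0
  exists_inv : ∀ i x, e i * x ≠ 0 → ∃ y, x * y * e i = e i

/-- A finite reduced commutative ring is a finite product of fields. -/
theorem exists_isFieldBlocks (A : Type*) [CommRing A] [Finite A] [IsReduced A] :
    ∃ (m : ℕ) (e : Fin m → A), IsFieldBlocks e := by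
  classical
  have : Finite (MaximalSpectrum A) := inferInstance
  have : Fintype (MaximalSpectrum A) := Fintype.ofFinite _
  let φ := (IsArtinianRing.equivPi A).toRingEquiv
  suffices h : ∃ e : MaximalSpectrum A → A, IsFieldBlocks e by
    obtain ⟨e, he⟩ := h
    let ψ := (Fintype.equivFin (MaximalSpectrum A)).symm
    exact ⟨_, e ∘ ψ, (CompleteOrthogonalIdempotents.equiv ψ).2 he.complete, fun i => he.ne_zero _, fun i => he.exists_inv _⟩
  have hp := (CompleteOrthogonalIdempotents.single
    (fun I : MaximalSpectrum A => A ⧸ I.asIdeal)).map φ.symm.toRingHom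
  refine ⟨_, hp, fun I => ?_, fun I x hx => ?_⟩
  · have : Nontrivial (A ⧸ I.asIdeal) := Ideal.Quotient.nontrivial_iff.2 I.isMaximal.ne_top
    simp
  · obtain ⟨x, rfl⟩ := φ.symm.surjective x
    have := I.isMaximal
    let := Ideal.Quotient.field I.asIdeal
    have hx' : x I ≠ 0 := by
      intro h0
      apply hx
      have : (Pi.single I 1 : ∀ J : MaximalSpectrum A, A ⧸ J.asIdeal) * x = 0 := by
        ext J
        by_cases hJ : J = I
        · subst hJ; simp [h0]
        · simp [Pi.single_eq_of_ne hJ]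
      simp only [Function.comp, RingEquiv.toRingHom_eq_coe, RingHom.coe_coe]
      rw [← map_mul, this, map_zero]
    refine ⟨φ.symm (Pi.single I (x I)⁻¹), ?_⟩
    simp only [Function.comp, RingEquiv.toRingHom_eq_coe, RingHom.coe_coe]
    rw [← map_mul, ← map_mul]
    congr 1
    ext J
    by_cases hJ : J = I
    · subst hJ; simp [mul_inv_cancel₀ hx']
    · simp [Pi.single_eq_of_ne hJ]

variable {A ι : Type*} [CommRing A] {e : ι → A}

/-- The ideal of elements supported on the blocks in `S`. -/
def blockIdeal (e : ι → A) (S : Finset ι) : Ideal A where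
  carrier := {t | ∀ i ∉ S, e i * t = 0}
  add_mem' {a b} ha hb i hi := by rw [mul_add, ha i hi, hb i hi, add_zero]
  zero_mem' i _ := mul_zero _
  smul_mem' c x hx i hi := by rw [smul_eq_mul, mul_left_comm, hx i hi, mul_zero]

theorem mem_blockIdeal {S : Finset ι} {t : A} :
    t ∈ blockIdeal e S ↔ ∀ i ∉ S, e i * t = 0 := Iff.rfl

variable [Fintype ι]

namespace IsFieldBlocks

theorem mul_self (he : IsFieldBlocks e) (i : ι) : e i * e i = e i := he.complete.idem i

theorem mul_of_ne (he : IsFieldBlocks e) {i j : ι} (h : i ≠ j) : e i * e j = 0 :=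
  he.complete.ortho h

theorem sum_mul (he : IsFieldBlocks e) (x : A) : ∑ i, e i * x = x := by
  rw [← Finset.sum_mul, he.complete.complete, one_mul]

theorem eq_zero (he : IsFieldBlocks e) {x : A} (h : ∀ i, e i * x = 0) : x = 0 := by
  rw [← he.sum_mul x]; simp [h]

theorem isPrimitive (he : IsFieldBlocks e) (i : ι) : IsPrimitiveIdempotent (e i) := by
  refine ⟨he.mul_self i, he.ne_zero i, fun f hf hfe => ?_⟩
  by_cases h0 : f = 0
  · exact Or.inl h0
  · right
    obtain ⟨y, hy⟩ := he.exists_inv i f (by rw [mul_comm, hfe]; exact h0)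
    calc f = f * e i := hfe.symm
      _ = f * (f * y * e i) := by rw [hy]
      _ = (f * f) * y * e i := by ring
      _ = e i := by rw [hf.eq, hy]

theorem right_eq_zero (he : IsFieldBlocks e) {i : ι} {x y : A} (h : e i * (x * y) = 0)
    (hx : e i * x ≠ 0) : e i * y = 0 := by
  obtain ⟨z, hz⟩ := he.exists_inv i x hx
  calc e i * y = (x * z * e i) * y := by rw [hz]
    _ = z * (e i * (x * y)) := by ring
    _ = 0 := by rw [h, mul_zero]

theorem isUnit (he : IsFieldBlocks e) {u : A} (h : ∀ i, e i * u ≠ 0) : IsUnit u := by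
  choose y hy using fun i => he.exists_inv i u (h i)
  refine IsUnit.of_mul_eq_one (∑ i, y i * e i) ?_
  rw [Finset.mul_sum, ← he.complete.complete]
  exact Finset.sum_congr rfl fun i _ => by rw [← mul_assoc, hy]

theorem mem_singleton (he : IsFieldBlocks e) {i : ι} {t : A} :
    t ∈ blockIdeal e {i} ↔ e i * t = t := by
  rw [mem_blockIdeal]
  constructor
  · intro h
    conv_rhs => rw [← he.sum_mul t]
    symm
    exact Finset.sum_eq_single i (fun j _ hj => h j (by simpa using hj)) (by simp)
  · intro h j hj
    rw [← h, ← mul_assoc, he.mul_of_ne (by simpa using hj), zero_mul]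

theorem blockIdeal_singleton (he : IsFieldBlocks e) (i : ι) :
    blockIdeal e {i} = Ideal.span {e i} := by
  ext t
  rw [he.mem_singleton, Ideal.mem_span_singleton]
  constructor
  · intro h; exact ⟨t, h.symm⟩
  · rintro ⟨c, rfl⟩; rw [← mul_assoc, he.mul_self]

/-- Summing one element from each block is injective, since multiplying by `e j` recovers the `j`-th
summand. This bounds the dimension of a sum of blocks from below. -/
theorem prod_card_le (he : IsFieldBlocks e) [Finite A] (S : Finset ι) :
    ∏ i ∈ S, Nat.card (blockIdeal e {i}) ≤ Nat.card (blockIdeal e S) := by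
  rw [← Finset.prod_coe_sort, ← Nat.card_pi]
  have key : ∀ (f : (i : S) → blockIdeal e {(i : ι)}) (j : S),
      e j * ∑ i : S, (f i : A) = f j := by
    intro f j
    rw [Finset.mul_sum, Finset.sum_eq_single j]
    · exact he.mem_singleton.1 (f j).2
    · intro i _ hij
      rw [← he.mem_singleton.1 (f i).2, ← mul_assoc, he.mul_of_ne, zero_mul]
      exact fun h => hij (Subtype.ext h.symm)
    · simp
  refine Nat.card_le_card_of_injective
    (fun f : (i : S) → blockIdeal e {(i : ι)} =>
      (⟨∑ i : S, (f i : A), ?_⟩ : blockIdeal e S)) ?_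
  · refine Ideal.sum_mem _ fun i _ => ?_
    intro j hj
    rw [← he.mem_singleton.1 (f i).2, ← mul_assoc, he.mul_of_ne, zero_mul]
    rintro rfl
    exact hj i.2
  · intro f g h
    funext j
    have h' : ∑ i : S, (f i : A) = ∑ i : S, (g i : A) := congrArg Subtype.val h
    apply Subtype.ext
    rw [← key f j, ← key g j, h']

/-- The equation `a b = c` has at most `|A| / |I|` solutions `b`, where `I` is the ideal of the
blocks on which `a` does not vanish. -/
theorem card_solutions_mul_le (he : IsFieldBlocks e) [Fintype A] [DecidableEq A] (a c : A) (S : Finset ι)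
    (hS : ∀ i, i ∈ S ↔ e i * a ≠ 0) :
    (Finset.univ.filter (fun b : A => a * b = c)).card * Nat.card (blockIdeal e S)
      ≤ Fintype.card A := by
  classical
  have := card_mul_natCard_le (Finset.univ.filter (fun b : A => a * b = c))
    (blockIdeal e S).toAddSubgroup 1 ?_
  · simpa using this
  · intro b hb
    rw [Finset.card_le_one]
    suffices h : ∀ x ∈ (Finset.univ.filter (fun b : A => a * b = c)).filter
        (fun x => x - b ∈ (blockIdeal e S).toAddSubgroup), x = b by
      intro x hx y hy; rw [h x hx, h y hy]
    intro x hx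
    simp only [Finset.mem_filter, Finset.mem_univ, true_and, Submodule.mem_toAddSubgroup] at hx hb
    have h0 : a * (x - b) = 0 := by rw [mul_sub, hx.1, hb, sub_self]
    refine sub_eq_zero.1 (he.eq_zero fun i => ?_)
    by_cases hi : i ∈ S
    · exact he.right_eq_zero (by rw [h0, mul_zero]) ((hS i).1 hi)
    · exact hx.2 i hi

/-- Few `b` have `1 + b b̄` vanishing on a given block, for a nontrivial involution. -/
theorem card_nonunit_le (he : IsFieldBlocks e) [Fintype A] [DecidableEq A] (bar : A →+* A)
    (hbar : ∀ x, bar (bar x) = x) (θ : A) (hθ : IsUnit (bar θ - θ)) (i : ι) :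
    (Finset.univ.filter (fun b : A => e i * (1 + b * bar b) = 0)).card ^ 2
      * Nat.card (blockIdeal e {i}) ≤ 4 * Fintype.card A ^ 2 := by
  classical
  set X := Finset.univ.filter (fun b : A => e i * (1 + b * bar b) = 0) with hX
  have hfe : IsIdempotentElem (e i * bar (e i)) := by
    have h2 : bar (e i) * bar (e i) = bar (e i) := by rw [← map_mul, he.mul_self]
    calc e i * bar (e i) * (e i * bar (e i)) = (e i * e i) * (bar (e i) * bar (e i)) := by ring
      _ = _ := by rw [he.mul_self, h2]
  -- By primitivity of `e i`, either bar moves this block off itself or it preserves the block.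
  rcases (he.isPrimitive i).2.2 (e i * bar (e i)) hfe
    (by rw [mul_right_comm, he.mul_self]) with h0 | h1
  -- Block moved: along a coset of the block `e i * bar x` is constant, so the equation is affine in
  -- `x` with slope `e i * bar b`. The slope is nonzero, since otherwise `e i = 0`; hence one
  -- solution per coset.
  · have key := card_mul_natCard_le X (blockIdeal e {i}).toAddSubgroup 1 ?_
    · have key' : X.card * Nat.card (blockIdeal e {i}) ≤ Fintype.card A := by simpa using key
      have hT : 0 < Nat.card (blockIdeal e {i}) := Nat.card_pos
      nlinarith [Nat.pow_le_pow_left key' 2]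
    · intro b hb
      rw [Finset.card_le_one]
      suffices h : ∀ x ∈ X.filter (fun x => x - b ∈ (blockIdeal e {i}).toAddSubgroup), x = b by
        intro x hx y hy; rw [h x hx, h y hy]
      intro x hx
      simp only [hX, Finset.mem_filter, Finset.mem_univ, true_and,
        Submodule.mem_toAddSubgroup] at hx hb
      have hx2 := he.mem_singleton.1 hx.2
      have hs : e i * bar (x - b) = 0 := by
        rw [← hx2, map_mul, ← mul_assoc, h0, zero_mul]
      have h3 : e i * (bar b * (x - b)) = 0 := by
        have h4 : e i * (1 + x * bar x) - e i * (1 + b * bar b) = 0 := by rw [hx.1, hb, sub_zero]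
        have h5 : bar (x - b) = bar x - bar b := map_sub _ _ _
        linear_combination h4 - x * hs + x * e i * h5
      have h6 : e i * bar b ≠ 0 := by
        intro h6
        apply he.ne_zero i
        linear_combination hb - b * h6
      have := he.right_eq_zero h3 h6
      rw [hx2] at this
      exact sub_eq_zero.1 this
  · have h2 : bar (e i) = e i := by
      have := congrArg bar h1
      rw [map_mul, hbar, mul_comm, h1] at this
      exact this.symm
    -- Block preserved: cosets of its bar-fixed part `T` are used. The traces of `x` and `θ x`
    -- determine `x` because `bar θ - θ` is a unit, so `T` has at least the square root of the size
    -- of the block.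
    let T : AddSubgroup A :=
      { carrier := {t | t ∈ blockIdeal e {i} ∧ bar t = t}
        add_mem' := fun {a b} ha hb => ⟨add_mem ha.1 hb.1, by rw [map_add, ha.2, hb.2]⟩
        zero_mem' := ⟨zero_mem _, map_zero _⟩
        neg_mem' := fun {a} ha => ⟨neg_mem ha.1, by rw [map_neg, ha.2]⟩ }
    have hT : Nat.card (blockIdeal e {i}) ≤ Nat.card T ^ 2 := by
      have hmem : ∀ x ∈ blockIdeal e {i}, x + bar x ∈ T := by
        intro x hx
        refine ⟨add_mem hx ?_, by rw [map_add, hbar, add_comm]⟩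
        rw [he.mem_singleton] at hx ⊢
        conv_rhs => rw [← hx]
        rw [map_mul, h2]
      rw [sq, ← Nat.card_prod]
      refine Nat.card_le_card_of_injective
        (fun x : blockIdeal e {i} => ((⟨x + bar x, hmem _ x.2⟩ : T),
          (⟨θ * x + bar (θ * x), hmem _ (Ideal.mul_mem_left _ _ x.2)⟩ : T))) ?_
      intro x y hxy
      simp only [Prod.mk.injEq, Subtype.mk.injEq, map_mul] at hxy
      apply Subtype.ext
      have : (bar θ - θ) * ((x : A) - y) = 0 := by
        linear_combination bar θ * hxy.1 - hxy.2
      exact sub_eq_zero.1 (hθ.mul_right_eq_zero.1 this)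
    have key := card_mul_natCard_le X T 2 ?_
    · calc X.card ^ 2 * Nat.card (blockIdeal e {i}) ≤ X.card ^ 2 * Nat.card T ^ 2 :=
            Nat.mul_le_mul_left _ hT
        _ = (X.card * Nat.card T) ^ 2 := by ring
        _ ≤ (2 * Fintype.card A) ^ 2 := Nat.pow_le_pow_left key 2
        _ = _ := by ring
    · intro b hb
      -- For `x = b + s` with `s` in `T`, the difference of the two equations is `s (b + bar b + s)
      -- = 0` on a field, which has two roots.
      refine le_trans (Finset.card_le_card (t := {b, b - e i * (b + bar b)}) ?_)
        Finset.card_le_two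
      intro x hx
      simp only [hX, Finset.mem_filter, Finset.mem_univ, true_and] at hx hb
      obtain ⟨hx0, hxT, hxb⟩ := hx
      have hx2 := he.mem_singleton.1 hxT
      have h3 : e i * ((x - b) * (b + bar b + (x - b))) = 0 := by
        have hxb' : bar x - bar b = x - b := by rw [← map_sub, hxb]
        linear_combination hx0 - hb - x * e i * hxb'
      simp only [Finset.mem_insert, Finset.mem_singleton]
      by_cases h4 : e i * (x - b) = 0
      · left; rw [hx2] at h4; exact sub_eq_zero.1 h4
      · right
        have := he.right_eq_zero h3 h4
        linear_combination this - hx2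

end IsFieldBlocks

end FieldBlocks

/-! ### Words of small weight in ideals of a group algebra -/

section BalancedCount

open MonoidAlgebra

theorem coeff_translate {S G : Type*} [Semiring S] [Group G] (g h : G) (x : MonoidAlgebra S G) :
    (single g 1 * x).coeff h = x.coeff (g⁻¹ * h) := by
  rw [coeff_single_mul_eq_mul_coeff (g⁻¹ * h), one_mul]
  intro m _
  rw [eq_inv_mul_iff_mul_eq]

open Classical in
-- The weight enumerator of `F^J` at `t`; it serves as the exponential moment in a Chernoff-type
-- bound.
theorem sum_prod_weight {F α : Type*} [Field F] [Fintype F] (J : Finset α) (t : ℝ) :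
    ∑ w : J → F, ∏ j, (if w j = 0 then 1 else t)
      = (1 + ((Fintype.card F : ℝ) - 1) * t) ^ J.card := by
  have h1 : ∑ a : F, (if a = 0 then 1 else t) = 1 + ((Fintype.card F : ℝ) - 1) * t := by
    rw [← Finset.add_sum_erase _ _ (Finset.mem_univ (0 : F)), if_pos rfl,
      Finset.sum_congr rfl fun a ha => if_neg (Finset.ne_of_mem_erase ha), Finset.sum_const,
      Finset.card_erase_of_mem (Finset.mem_univ _), Finset.card_univ, nsmul_eq_mul,
      Nat.cast_sub Fintype.card_pos, Nat.cast_one]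
  have := Finset.prod_univ_sum (fun _ : J => (Finset.univ : Finset F))
    (fun _ a => if a = 0 then (1 : ℝ) else t)
  rw [Fintype.piFinset_univ] at this
  rw [← this, h1, Finset.prod_const, Finset.card_univ, Fintype.card_coe]

variable {F G : Type*} [Field F] [CommGroup G] [Fintype G]

/-- The coefficient at `g`, as a linear functional. -/
noncomputable def coeffLinear (F : Type*) {G : Type*} [Field F] [CommGroup G] (g : G) :
    MonoidAlgebra F G →ₗ[F] F where
  toFun x := x.coeff g
  map_add' _ _ := rfl
  map_smul' _ _ := rfl

instance finiteDimensional_monoidAlgebra : FiniteDimensional F (MonoidAlgebra F G) :=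
  Module.Finite.of_surjective
    ({ toFun := fun x => MonoidAlgebra.ofCoeff x, map_add' := fun _ _ => rfl,
       map_smul' := fun _ _ => rfl } : (G →₀ F) →ₗ[F] MonoidAlgebra F G)
    (fun x => ⟨x.coeff, rfl⟩)

instance finite_monoidAlgebra {S : Type*} [Semiring S] [Finite S] :
    Finite (MonoidAlgebra S G) :=
  Finite.of_injective (fun x : MonoidAlgebra S G => (fun g => x.coeff g))
    (fun x y h => by ext g; exact congrFun h g)

/-- Information sets: some `dim V` coordinates determine the elements of `V`. -/
theorem exists_informationSet (V : Submodule F (MonoidAlgebra F G)) :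
    ∃ J : Finset G, J.card ≤ Module.finrank F V ∧
      ∀ x ∈ V, (∀ g ∈ J, x.coeff g = 0) → x = 0 := by
  classical
  -- A maximal independent family of coordinate functionals on `V` spans all of them, so its
  -- vanishing at `x` forces every coordinate of `x` to vanish.
  obtain ⟨κ, a, ha, hspan, hli⟩ := exists_linearIndependent' F
    (fun g : G => (coeffLinear F g).comp V.subtype)
  have : Finite κ := Finite.of_injective a ha
  have := Fintype.ofFinite κ
  refine ⟨Finset.univ.image a, ?_, fun x hx h0 => ?_⟩
  · rw [Finset.card_image_of_injective _ ha, Finset.card_univ]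
    have := hli.fintype_card_le_finrank
    rwa [Subspace.dual_finrank_eq] at this
  · have hle : Submodule.span F (Set.range (fun g : G => (coeffLinear F g).comp V.subtype))
        ≤ LinearMap.ker (Module.Dual.eval F V ⟨x, hx⟩) := by
      rw [← hspan, Submodule.span_le]
      rintro _ ⟨k, rfl⟩
      exact h0 (a k) (Finset.mem_image_of_mem _ (Finset.mem_univ _))
    ext g
    exact hle (Submodule.subset_span ⟨g, rfl⟩)

open Classical in
-- Double counting: at each fixed position, exactly `wt(x)` of the translates of `x` are nonzero.
-- Hence some translate has at most the average weight `|J| wt(x) / |G|` on `J`.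
theorem sum_card_translate (J : Finset G) (x : MonoidAlgebra F G) :
    ∑ g : G, (J.filter (fun h => (single g (1 : F) * x).coeff h ≠ 0)).card
      = J.card * x.coeff.support.card := by
  have := Finset.sum_card_bipartiteAbove_eq_sum_card_bipartiteBelow (s := Finset.univ) (t := J)
    (fun (g : G) h => (single g (1 : F) * x).coeff h ≠ 0)
  simp only [Finset.bipartiteAbove, Finset.bipartiteBelow] at this
  rw [this, ← smul_eq_mul, ← Finset.sum_const]
  refine Finset.sum_congr rfl fun h _ => ?_
  refine Finset.card_bij (fun g _ => g⁻¹ * h) ?_ ?_ ?_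
  · intro g hg
    simpa [coeff_translate] using hg
  · intro g _ g' _ hgg
    simpa using hgg
  · intro k hk
    refine ⟨h * k⁻¹, ?_, by simp⟩
    simpa [coeff_translate] using hk

open Classical in
/-- Ideals of group algebras are balanced: they contain few words of small weight. -/
theorem card_lowWeight_le [Fintype F] [Fintype (MonoidAlgebra F G)]
    (I : Ideal (MonoidAlgebra F G)) {t δ c : ℝ} (ht0 : 0 < t) (ht1 : t ≤ 1)
    (hc : 1 + ((Fintype.card F : ℝ) - 1) * t ≤ c * t ^ δ) :
    ((Finset.univ.filter (fun x : MonoidAlgebra F G =>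
      x ∈ I ∧ (x.coeff.support.card : ℝ) ≤ δ * Fintype.card G)).card : ℝ)
      ≤ Fintype.card G * c ^ Module.finrank F I := by
  obtain ⟨J, hJ, hJ0⟩ := exists_informationSet (I.restrictScalars F)
  change J.card ≤ Module.finrank F I at hJ
  set d := Module.finrank F I
  set X := Finset.univ.filter (fun x : MonoidAlgebra F G =>
      x ∈ I ∧ (x.coeff.support.card : ℝ) ≤ δ * Fintype.card G) with hX
  set ψ : MonoidAlgebra F G → ℝ := fun y => ∏ j : J, (if y.coeff j = 0 then 1 else t) with hψ
  have hψ0 : ∀ y, 0 ≤ ψ y := fun y => Finset.prod_nonneg fun j _ => by split_ifs <;> positivity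
  have hψt : ∀ y, ψ y = t ^ (J.filter (fun h => y.coeff h ≠ 0)).card := by
    intro y
    simp only [hψ]
    rw [Finset.prod_coe_sort J (fun j => if y.coeff j = 0 then (1 : ℝ) else t), Finset.prod_ite]
    simp
  have hGpos : (0 : ℝ) < Fintype.card G := by exact_mod_cast Fintype.card_pos
  -- By averaging, a word of weight at most `δ |G|` has a translate of weight at most `δ d` on `J`;
  -- as `t ≤ 1`, that translate alone contributes enough.
  have hlow : ∀ x ∈ X, (t ^ δ) ^ d ≤ ∑ g : G, ψ (single g 1 * x) := by
    intro x hx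
    have hx2 := (Finset.mem_filter.1 hx).2.2
    obtain ⟨g, hg⟩ : ∃ g : G,
        ((J.filter (fun h => (single g (1 : F) * x).coeff h ≠ 0)).card : ℝ) ≤ δ * d := by
      by_contra! hcon
      have h1 : ∑ _g : G, δ * d <
          ∑ g : G, ((J.filter (fun h => (single g (1 : F) * x).coeff h ≠ 0)).card : ℝ) :=
        Finset.sum_lt_sum_of_nonempty Finset.univ_nonempty fun g _ => hcon g
      have h2 : ∑ g : G, ((J.filter (fun h => (single g (1 : F) * x).coeff h ≠ 0)).card : ℝ)
          = J.card * x.coeff.support.card := by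
        exact_mod_cast sum_card_translate J x
      rw [h2, Finset.sum_const, Finset.card_univ, nsmul_eq_mul] at h1
      have h3 : (J.card : ℝ) * x.coeff.support.card ≤ d * (δ * Fintype.card G) := by
        have : (J.card : ℝ) ≤ d := by exact_mod_cast hJ
        gcongr
      linarith
    calc (t ^ δ) ^ d = t ^ (δ * d) := by rw [Real.rpow_mul ht0.le, Real.rpow_natCast]
      _ ≤ t ^ ((J.filter (fun h => (single g (1 : F) * x).coeff h ≠ 0)).card : ℝ) :=
          Real.rpow_le_rpow_of_exponent_ge ht0 ht1 hg
      _ = ψ (single g 1 * x) := by rw [hψt, Real.rpow_natCast]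
      _ ≤ _ := Finset.single_le_sum (f := fun g => ψ (single g 1 * x))
          (fun g _ => hψ0 _) (Finset.mem_univ g)
  -- Translation preserves the ideal and `J` determines its elements, so the sum is part of the full
  -- weight enumerator of `F^J`.
  have hsum : ∀ g : G, ∑ x ∈ X, ψ (single g 1 * x)
      ≤ (1 + ((Fintype.card F : ℝ) - 1) * t) ^ J.card := by
    intro g
    rw [← sum_prod_weight J t]
    have hinj : Set.InjOn (fun (x : MonoidAlgebra F G) (j : J) => (single g 1 * x).coeff j)
        (X : Set (MonoidAlgebra F G)) := by
      intro x hx y hy hxy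
      have hxI := (Finset.mem_filter.1 hx).2.1
      have hyI := (Finset.mem_filter.1 hy).2.1
      have h0 : single g (1 : F) * (x - y) = 0 := by
        refine hJ0 _ (Ideal.mul_mem_left _ _ (sub_mem hxI hyI)) fun j hj => ?_
        have := congrFun hxy ⟨j, hj⟩
        simp only at this
        rw [mul_sub]
        change (single g 1 * x).coeff j - (single g 1 * y).coeff j = 0
        rw [this, sub_self]
      have h1 : single g⁻¹ (1 : F) * (single g 1 * (x - y)) = x - y := by
        rw [← mul_assoc, single_mul_single, inv_mul_cancel, mul_one, ← one_def, one_mul]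
      rw [h0, mul_zero] at h1
      exact sub_eq_zero.1 h1.symm
    calc ∑ x ∈ X, ψ (single g 1 * x)
        = ∑ w ∈ (X.image (fun x j => (single g 1 * x).coeff j.1) : Finset (J → F)),
            ∏ j, (if w j = 0 then 1 else t) := by
          rw [Finset.sum_image hinj]
      _ ≤ _ := Finset.sum_le_sum_of_subset_of_nonneg (Finset.subset_univ _)
          fun w _ _ => Finset.prod_nonneg fun j _ => by split_ifs <;> positivity
  have hN : (1 : ℝ) ≤ Fintype.card F := by exact_mod_cast Fintype.card_pos
  have hbase : 1 ≤ 1 + ((Fintype.card F : ℝ) - 1) * t := by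
    have : 0 ≤ ((Fintype.card F : ℝ) - 1) * t := mul_nonneg (by linarith) ht0.le
    linarith
  have hpos : 0 < (t ^ δ) ^ d := by positivity
  refine le_of_mul_le_mul_right ?_ hpos
  calc (X.card : ℝ) * (t ^ δ) ^ d = ∑ x ∈ X, (t ^ δ) ^ d := by simp
    _ ≤ ∑ x ∈ X, ∑ g : G, ψ (single g 1 * x) := Finset.sum_le_sum hlow
    _ = ∑ g : G, ∑ x ∈ X, ψ (single g 1 * x) := Finset.sum_comm
    _ ≤ ∑ _g : G, (1 + ((Fintype.card F : ℝ) - 1) * t) ^ J.card :=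
        Finset.sum_le_sum fun g _ => hsum g
    _ = Fintype.card G * (1 + ((Fintype.card F : ℝ) - 1) * t) ^ J.card := by simp
    _ ≤ Fintype.card G * (c * t ^ δ) ^ d := by
        gcongr
        exact (pow_le_pow_right₀ hbase hJ).trans (pow_le_pow_left₀ (by linarith) hc d)
    _ = Fintype.card G * c ^ d * (t ^ δ) ^ d := by rw [mul_pow]; ring

/-- Suitable parameters for `card_lowWeight_le`. -/
theorem exists_balanced_parameters (N : ℝ) {c : ℝ} (hc : 1 < c) :
    ∃ t δ : ℝ, 0 < t ∧ t ≤ 1 ∧ 0 < δ ∧ δ < 1 ∧ 1 + (N - 1) * t ≤ c * t ^ δ := by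
  -- With `1 < m < c`, first `t` is taken small enough for the left side to be below `m`, then `δ`
  -- small enough for `c * t ^ δ` to exceed `m`.
  set m := (1 + c) / 2 with hm
  have h1 : ∀ᶠ t in 𝓝[>] (0 : ℝ), 1 + (N - 1) * t < m := by
    have : Tendsto (fun t : ℝ => 1 + (N - 1) * t) (𝓝[>] 0) (𝓝 (1 + (N - 1) * 0)) :=
      (Continuous.tendsto (by fun_prop) 0).mono_left nhdsWithin_le_nhds
    exact this.eventually_lt_const (by rw [hm]; linarith)
  obtain ⟨t, ht, htm⟩ := (h1.and (Ioc_mem_nhdsGT (zero_lt_one (α := ℝ)))).exists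
  have h2 : ∀ᶠ δ in 𝓝[>] (0 : ℝ), m < c * t ^ δ := by
    have : Tendsto (fun δ : ℝ => c * t ^ δ) (𝓝[>] 0) (𝓝 (c * t ^ (0 : ℝ))) :=
      (((Real.continuous_const_rpow htm.1.ne').tendsto 0).const_mul c).mono_left
        nhdsWithin_le_nhds
    exact this.eventually_const_lt (by rw [Real.rpow_zero, hm]; linarith)
  obtain ⟨δ, hδ, hδ1⟩ := (h2.and (Ioo_mem_nhdsGT (zero_lt_one (α := ℝ)))).exists
  exact ⟨t, δ, htm.1, htm.2, hδ1.1, hδ1.2, by linarith⟩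

end BalancedCount

/-! ### The Hermitian involution -/

section Bar

open MonoidAlgebra

/-- The involution `∑ a_g g ↦ ∑ σ(a_g) g⁻¹` of a group algebra. -/
noncomputable def barHom {S : Type*} (G : Type*) [CommSemiring S] [CommGroup G] (σ : S →+* S) :
    MonoidAlgebra S G →+* MonoidAlgebra S G :=
  (mapRingHom G σ).comp (mapDomainRingHom S (invMonoidHom : G →* G))

variable {S G : Type*} [CommSemiring S] [CommGroup G]

theorem barHom_single (σ : S →+* S) (g : G) (s : S) :
    barHom G σ (single g s) = single g⁻¹ (σ s) := by
  simp [barHom]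

theorem coeff_barHom (σ : S →+* S) (x : MonoidAlgebra S G) (g : G) :
    (barHom G σ x).coeff g = σ (x.coeff g⁻¹) := by
  induction x using MonoidAlgebra.induction_linear with
  | zero => simp
  | add x y hx hy => simp [hx, hy]
  | single h s =>
    classical
    rw [barHom_single]
    simp [Finsupp.single_apply, inv_eq_iff_eq_inv, apply_ite σ]

theorem barHom_barHom {σ : S →+* S} (hσ : ∀ s, σ (σ s) = s) (x : MonoidAlgebra S G) :
    barHom G σ (barHom G σ x) = x := by
  ext g
  simp [coeff_barHom, hσ]

end Bar

/-! ### The trivial idempotent -/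

section TrivialIdempotent

open MonoidAlgebra

variable {F G : Type*} [Field F] [CommGroup G] [Fintype G]

theorem coeff_trivialIdempotent (g : G) :
    (trivialIdempotent F G).coeff g = (Fintype.card G : F)⁻¹ := by
  classical
  simp [trivialIdempotent, Finsupp.finsetSum_apply, Finsupp.single_apply]

theorem trivialIdempotent_mul (x : MonoidAlgebra F G) :
    trivialIdempotent F G * x = (∑ g, x.coeff g) • trivialIdempotent F G := by
  induction x using MonoidAlgebra.induction_linear with
  | zero => simp
  | add x y hx hy => simp [mul_add, hx, hy, Finset.sum_add_distrib, add_smul]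
  | single h s =>
    classical
    ext g
    rw [mul_comm, coeff_single_mul_eq_mul_coeff (h⁻¹ * g)]
    · simp [coeff_trivialIdempotent, Finsupp.single_apply]
    · intro m _
      rw [eq_inv_mul_iff_mul_eq]

theorem sum_coeff_trivialIdempotent (hn : (Fintype.card G : F) ≠ 0) :
    ∑ g, (trivialIdempotent F G).coeff g = 1 := by
  simp [coeff_trivialIdempotent, mul_inv_cancel₀ hn]

theorem isIdempotentElem_trivialIdempotent (hn : (Fintype.card G : F) ≠ 0) :
    IsIdempotentElem (trivialIdempotent F G) := by
  unfold IsIdempotentElem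
  rw [trivialIdempotent_mul, sum_coeff_trivialIdempotent hn, one_smul]

theorem trivialIdempotent_ne_zero (hn : (Fintype.card G : F) ≠ 0) :
    trivialIdempotent F G ≠ 0 := by
  intro h
  have := sum_coeff_trivialIdempotent (F := F) (G := G) hn
  simp [h] at this

/-- Some `e i * e₀` is nonzero, hence equals `e i` by primitivity. It is also a scalar multiple of
`e₀`, and being a nonzero idempotent it must be `e₀` itself. -/
theorem IsFieldBlocks.exists_eq_trivialIdempotent {ι : Type*} [Fintype ι]
    {e : ι → MonoidAlgebra F G} (he : IsFieldBlocks e) (hn : (Fintype.card G : F) ≠ 0) :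
    ∃ i, e i = trivialIdempotent F G := by
  by_contra! hcon
  apply trivialIdempotent_ne_zero (F := F) (G := G) hn
  refine he.eq_zero fun i => ?_
  set e₀ := trivialIdempotent F G
  have h0 := isIdempotentElem_trivialIdempotent (F := F) (G := G) hn
  have hid : IsIdempotentElem (e i * e₀) := by
    unfold IsIdempotentElem
    rw [mul_mul_mul_comm, he.mul_self, h0.eq]
  rcases (he.isPrimitive i).2.2 _ hid (by rw [mul_right_comm, he.mul_self]) with h | h
  · exact h
  · exfalso
    have h1 : e₀ * e i = (∑ g, (e i).coeff g) • e₀ := trivialIdempotent_mul (e i)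
    rw [mul_comm, h] at h1
    have hc : (∑ g, (e i).coeff g) = 1 := by
      have h3 := he.mul_self i
      rw [h1, smul_mul_smul_comm, h0.eq, ← sub_eq_zero, ← sub_smul] at h3
      rcases smul_eq_zero.1 h3 with h4 | h4
      · have h5 : (∑ g, (e i).coeff g) ≠ 0 := by
          intro h5
          rw [h5, zero_smul] at h1
          exact he.ne_zero i h1
        have h6 : (∑ g, (e i).coeff g) * ((∑ g, (e i).coeff g) - 1) = 0 := by
          rw [← h4]; ring
        exact sub_eq_zero.1 ((mul_eq_zero.1 h6).resolve_left h5)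
      · exact absurd h4 (trivialIdempotent_ne_zero hn)
    rw [hc, one_smul] at h1
    exact hcon i h1

/-- Such an `x` is a nonzero constant word. Thus the trivial block, although one-dimensional, never
yields small weight. -/
theorem card_support_of_trivialIdempotent_mul (hn : (Fintype.card G : F) ≠ 0)
    {x : MonoidAlgebra F G} (hx : x ≠ 0) (h : trivialIdempotent F G * x = x) :
    x.coeff.support.card = Fintype.card G := by
  rw [← Finset.card_univ]
  congr 1
  rw [Finset.eq_univ_iff_forall]
  intro g
  rw [Finsupp.mem_support_iff]
  rw [trivialIdempotent_mul] at h
  rw [← h]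
  have hs : (∑ g, x.coeff g) ≠ 0 := by
    intro h0
    rw [h0, zero_smul] at h
    exact hx h.symm
  rw [coeff_smul_apply, coeff_trivialIdempotent, smul_eq_mul]
  exact mul_ne_zero hs (inv_ne_zero hn)

open Classical in
-- An element is recovered from its component killed by `e₀` and its coefficient sum.
theorem card_le_card_annihilator_mul [Fintype F] [Fintype (MonoidAlgebra F G)]
    (hn : (Fintype.card G : F) ≠ 0) :
    Fintype.card (MonoidAlgebra F G) ≤
      (Finset.univ.filter (fun b : MonoidAlgebra F G => trivialIdempotent F G * b = 0)).card
        * Fintype.card F := by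
  rw [← Fintype.card_coe, ← Fintype.card_prod]
  refine Fintype.card_le_of_injective (fun x => (⟨x - trivialIdempotent F G * x, ?_⟩,
    ∑ g, x.coeff g)) ?_
  · simp only [Finset.mem_filter, Finset.mem_univ, true_and]
    rw [mul_sub, ← mul_assoc, (isIdempotentElem_trivialIdempotent hn).eq, sub_self]
  · intro x y hxy
    simp only [Prod.mk.injEq, Subtype.mk.injEq] at hxy
    obtain ⟨h1, h2⟩ := hxy
    rw [trivialIdempotent_mul, trivialIdempotent_mul, h2] at h1
    exact sub_left_injective h1

theorem isReduced_monoidAlgebra [Finite F] (hn : (Fintype.card G : F) ≠ 0) :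
    IsReduced (MonoidAlgebra F G) := by
  have : NeZero (Nat.card G : F) := ⟨by rwa [Nat.card_eq_fintype_card]⟩
  have : IsSemisimpleRing (MonoidAlgebra F G) := inferInstance
  infer_instance

theorem finrank_monoidAlgebra_le : Module.finrank F (MonoidAlgebra F G) ≤ Fintype.card G := by
  have := LinearMap.finrank_le_finrank_of_injective (f := LinearMap.pi (coeffLinear F (G := G)))
    (fun x y h => by ext g; exact congrFun h g)
  simpa using this

theorem IsFieldBlocks.card_le [Finite F] {m : ℕ} {e : Fin m → MonoidAlgebra F G}
    (he : IsFieldBlocks e) : m ≤ Fintype.card G := by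
  have hli : LinearIndependent F e := by
    rw [Fintype.linearIndependent_iff]
    intro c hc i
    have h := congrArg (fun x => e i * x) hc
    simp only [Finset.mul_sum, mul_zero, mul_smul_comm] at h
    rw [Finset.sum_eq_single i (fun j _ hj => by rw [he.mul_of_ne hj.symm, smul_zero])
      (by simp), he.mul_self] at h
    exact (smul_eq_zero.1 h).resolve_right (he.ne_zero i)
  have h1 := hli.fintype_card_le_finrank
  simpa using h1.trans finrank_monoidAlgebra_le

end TrivialIdempotent

/-! ### The least dimension of a nontrivial block -/

section MinIdempotentDim

variable {F G : Type*} [Field F] [CommGroup G] [Fintype G]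

theorem minIdempotentDim_le {ι : Type*} [Fintype ι]
    {e : ι → MonoidAlgebra F G} (he : IsFieldBlocks e) {i : ι} (hi : e i ≠ trivialIdempotent F G) :
    minIdempotentDim F G ≤ Module.finrank F (blockIdeal e {i}) := by
  rw [he.blockIdeal_singleton]
  exact Nat.sInf_le ⟨e i, he.isPrimitive i, hi, rfl⟩

/-- Otherwise `1 = e₀`, which is absurd at any `g ≠ 1`. This rules out the default value 0 of the
infimum over an empty set in `minIdempotentDim`. -/
theorem exists_nontrivial_primitiveIdempotent [Finite F] (hn : (Fintype.card G : F) ≠ 0)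
    (h1 : 1 < Fintype.card G) :
    ∃ e : MonoidAlgebra F G, IsPrimitiveIdempotent e ∧ e ≠ trivialIdempotent F G := by
  have := isReduced_monoidAlgebra (G := G) hn
  obtain ⟨m, e, he⟩ := exists_isFieldBlocks (MonoidAlgebra F G)
  by_contra! hcon
  have hall : ∀ i, e i = trivialIdempotent F G := fun i => hcon _ (he.isPrimitive i)
  obtain ⟨i₀, hi₀⟩ := he.exists_eq_trivialIdempotent hn
  have hone : (1 : MonoidAlgebra F G) = trivialIdempotent F G := by
    rw [← he.complete.complete, Finset.sum_eq_single i₀, hi₀]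
    · intro j _ hj
      have := he.mul_of_ne hj
      rwa [hall j, hall i₀, (isIdempotentElem_trivialIdempotent hn).eq, ← hall j] at this
    · simp
  obtain ⟨g, hg⟩ := Fintype.exists_ne_of_one_lt_card h1 1
  have h2 := coeff_trivialIdempotent (F := F) g
  rw [← hone, MonoidAlgebra.one_def] at h2
  rw [MonoidAlgebra.coeff_single, Finsupp.single_eq_of_ne hg] at h2
  exact inv_ne_zero hn h2.symm

theorem minIdempotentDim_pos [Finite F] (hn : (Fintype.card G : F) ≠ 0)
    (h1 : 1 < Fintype.card G) : 0 < minIdempotentDim F G := by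
  obtain ⟨e, he, hne⟩ := exists_nontrivial_primitiveIdempotent (F := F) (G := G) hn h1
  obtain ⟨e', he', -, hd⟩ := Nat.sInf_mem (s := {d : ℕ | ∃ e : MonoidAlgebra F G,
    IsPrimitiveIdempotent e ∧ e ≠ trivialIdempotent F G ∧
    d = Module.finrank F (Ideal.span {e} : Ideal (MonoidAlgebra F G))}) ⟨_, e, he, hne, rfl⟩
  unfold minIdempotentDim
  rw [hd]
  have hmem : e' ∈ (Ideal.span {e'}).restrictScalars F := Ideal.mem_span_singleton_self e'
  have : Nontrivial ((Ideal.span {e'}).restrictScalars F) :=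
    ⟨⟨⟨e', hmem⟩, 0, fun h => he'.2.1 (congrArg Subtype.val h)⟩⟩
  exact Module.finrank_pos (R := F) (M := (Ideal.span {e'}).restrictScalars F)

theorem minIdempotentDim_le_card [Finite F] (hn : (Fintype.card G : F) ≠ 0)
    (h1 : 1 < Fintype.card G) : minIdempotentDim F G ≤ Fintype.card G := by
  obtain ⟨e, he, hne⟩ := exists_nontrivial_primitiveIdempotent (F := F) (G := G) hn h1
  have h : minIdempotentDim F G ≤ Module.finrank F (Ideal.span {e}) :=
    Nat.sInf_le ⟨e, he, hne, rfl⟩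
  refine h.trans ?_
  exact (Submodule.finrank_le ((Ideal.span {e}).restrictScalars F)).trans finrank_monoidAlgebra_le

end MinIdempotentDim

/-! ### Counting the bad multipliers -/

section RandomChoice

variable {F G : Type*} [Field F] [CommGroup G] [Fintype G]

theorem natCard_ideal [Fintype F] {q : ℕ} (hq : Fintype.card F = q ^ 2)
    (I : Ideal (MonoidAlgebra F G)) :
    Nat.card I = (q ^ Module.finrank F I) ^ 2 := by
  have := Module.natCard_eq_pow_finrank (K := F) (V := I.restrictScalars F)
  rw [Nat.card_eq_fintype_card (α := F), hq] at this
  rw [← pow_mul, mul_comm, pow_mul]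
  exact this

open Classical in
/-- The elements `b` for which some low-weight `(a, ab)` has `a` supported exactly on the blocks
in `S`. -/
noncomputable def lowWeightMultipliers {ι : Type*} [Fintype (MonoidAlgebra F G)]
    (e : ι → MonoidAlgebra F G) (δ : ℝ) (S : Finset ι) : Finset (MonoidAlgebra F G) :=
  Finset.univ.filter (fun b => ∃ a, (∀ i, i ∈ S ↔ e i * a ≠ 0) ∧
    (a.coeff.support.card : ℝ) ≤ δ * Fintype.card G ∧
    ((a * b).coeff.support.card : ℝ) ≤ δ * Fintype.card G)

theorem mem_lowWeightMultipliers {ι : Type*} [Fintype (MonoidAlgebra F G)]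
    {e : ι → MonoidAlgebra F G} {δ : ℝ} {S : Finset ι} {b : MonoidAlgebra F G} :
    b ∈ lowWeightMultipliers e δ S ↔ ∃ a, (∀ i, i ∈ S ↔ e i * a ≠ 0) ∧
      (a.coeff.support.card : ℝ) ≤ δ * Fintype.card G ∧
      ((a * b).coeff.support.card : ℝ) ≤ δ * Fintype.card G := by
  simp [lowWeightMultipliers]

open Classical in
-- Both `a` and `ab` are light words of the ideal of `S`, giving at most `(|G| c^d)²` pairs; each
-- pair leaves at most `|A| / q^(2d)` choices of `b`. Since `c² ≤ q`, one factor `q^d` remains.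
theorem card_lowWeightMultipliers_le [Fintype F] {q : ℕ} (hq : Fintype.card F = q ^ 2)
    {m : ℕ} {e : Fin m → MonoidAlgebra F G} (he : IsFieldBlocks e)
    [Fintype (MonoidAlgebra F G)] {t δ c : ℝ} (ht0 : 0 < t) (ht1 : t ≤ 1)
    (hc : 1 + ((Fintype.card F : ℝ) - 1) * t ≤ c * t ^ δ) (hcq : c ^ 2 ≤ q)
    (S : Finset (Fin m)) :
    ((lowWeightMultipliers e δ S).card : ℝ) * q ^ Module.finrank F (blockIdeal e S)
      ≤ Fintype.card G ^ 2 * Fintype.card (MonoidAlgebra F G) := by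
  set I := blockIdeal e S
  set d := Module.finrank F I
  set L := Finset.univ.filter (fun x : MonoidAlgebra F G =>
      x ∈ I ∧ (x.coeff.support.card : ℝ) ≤ δ * Fintype.card G)
  have hL : (L.card : ℝ) ≤ Fintype.card G * c ^ d := card_lowWeight_le I ht0 ht1 hc
  have hsub : lowWeightMultipliers e δ S ⊆
      ((L.filter fun a => ∀ i, i ∈ S ↔ e i * a ≠ 0) ×ˢ L).biUnion
        (fun p => Finset.univ.filter (fun b => p.1 * b = p.2)) := by
    intro b hb
    obtain ⟨a, ha, hw, hw'⟩ := mem_lowWeightMultipliers.1 hb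
    have haI : a ∈ I := fun i hi => not_not.1 (mt (ha i).2 hi)
    simp only [Finset.mem_biUnion, Finset.mem_product, Prod.exists]
    refine ⟨a, a * b, ⟨?_, ?_⟩, by simp⟩
    · simp only [L, Finset.mem_filter, Finset.mem_univ, true_and]
      exact ⟨⟨haI, hw⟩, ha⟩
    · simp only [L, Finset.mem_filter, Finset.mem_univ, true_and]
      exact ⟨Ideal.mul_mem_right _ _ haI, hw'⟩
  have hnat : (lowWeightMultipliers e δ S).card * Nat.card I
      ≤ L.card ^ 2 * Fintype.card (MonoidAlgebra F G) := by
    calc _ ≤ (∑ p ∈ (L.filter fun a => ∀ i, i ∈ S ↔ e i * a ≠ 0) ×ˢ L,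
          (Finset.univ.filter (fun b => p.1 * b = p.2)).card) * Nat.card I :=
          Nat.mul_le_mul_right _ ((Finset.card_le_card hsub).trans Finset.card_biUnion_le)
      _ = ∑ p ∈ (L.filter fun a => ∀ i, i ∈ S ↔ e i * a ≠ 0) ×ˢ L,
          (Finset.univ.filter (fun b => p.1 * b = p.2)).card * Nat.card I := Finset.sum_mul ..
      _ ≤ ∑ p ∈ (L.filter fun a => ∀ i, i ∈ S ↔ e i * a ≠ 0) ×ˢ L,
          Fintype.card (MonoidAlgebra F G) := by
          refine Finset.sum_le_sum fun p hp => ?_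
          rw [Finset.mem_product, Finset.mem_filter] at hp
          exact he.card_solutions_mul_le p.1 p.2 S hp.1.2
      _ ≤ L.card ^ 2 * Fintype.card (MonoidAlgebra F G) := by
          rw [Finset.sum_const, Finset.card_product, smul_eq_mul, sq]
          gcongr
          exact Finset.filter_subset _ _
  rw [natCard_ideal hq] at hnat
  have hqpos : 0 < q := by
    rcases Nat.eq_zero_or_pos q with h | h
    · have := Fintype.card_pos (α := F); rw [hq, h] at this; simp at this
    · exact h
  have hqd : (0 : ℝ) < (q : ℝ) ^ d := by positivity
  have hreal : ((lowWeightMultipliers e δ S).card : ℝ) * ((q : ℝ) ^ d) ^ 2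
      ≤ (L.card : ℝ) ^ 2 * Fintype.card (MonoidAlgebra F G) := by exact_mod_cast hnat
  refine le_of_mul_le_mul_right ?_ hqd
  calc ((lowWeightMultipliers e δ S).card : ℝ) * q ^ d * q ^ d
      = ((lowWeightMultipliers e δ S).card : ℝ) * ((q : ℝ) ^ d) ^ 2 := by ring
    _ ≤ (L.card : ℝ) ^ 2 * Fintype.card (MonoidAlgebra F G) := hreal
    _ ≤ (Fintype.card G * c ^ d) ^ 2 * Fintype.card (MonoidAlgebra F G) := by gcongr
    _ = Fintype.card G ^ 2 * Fintype.card (MonoidAlgebra F G) * (c ^ 2) ^ d := by ring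
    _ ≤ Fintype.card G ^ 2 * Fintype.card (MonoidAlgebra F G) * (q : ℝ) ^ d := by gcongr

open Classical in
/-- If few elements are bad, some `b` yields a Hermitian LCD code with large minimum weight. -/
theorem exists_isUnit_and_weight [Fintype F] {q : ℕ} (hq : Fintype.card F = q ^ 2)
    (hn : (Fintype.card G : F) ≠ 0) {σ : F →+* F} (hσ : ∀ x, σ (σ x) = x) {θ : F}
    (hθ : σ θ ≠ θ) {t δ c : ℝ} (ht0 : 0 < t) (ht1 : t ≤ 1) (hδ : δ < 1)
    (hc : 1 + ((Fintype.card F : ℝ) - 1) * t ≤ c * t ^ δ) (hcq : c ^ 2 ≤ q)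
    (hsmall : 2 * Fintype.card G * (1 / (q : ℝ) ^ minIdempotentDim F G) +
      2 * Fintype.card G ^ 2 *
        ((1 + 1 / (q : ℝ) ^ minIdempotentDim F G) ^ Fintype.card G - 1) < 1 / (q : ℝ) ^ 2) :
    ∃ b : MonoidAlgebra F G, IsUnit (1 + b * barHom G σ b) ∧ ∀ a, a ≠ 0 →
      δ * Fintype.card G < a.coeff.support.card + (a * b).coeff.support.card := by
  have := isReduced_monoidAlgebra (G := G) hn
  have := Fintype.ofFinite (MonoidAlgebra F G)
  obtain ⟨m, e, he⟩ := exists_isFieldBlocks (MonoidAlgebra F G)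
  obtain ⟨i₀, hi₀⟩ := he.exists_eq_trivialIdempotent hn
  have hm : m ≤ Fintype.card G := he.card_le
  set μ := minIdempotentDim F G
  set n := Fintype.card G with hndef
  set A := Fintype.card (MonoidAlgebra F G) with hA
  have hApos : (0 : ℝ) < A := by
    have : 0 < A := Fintype.card_pos
    exact_mod_cast this
  have hq1 : 1 ≤ q := by
    rcases Nat.eq_zero_or_pos q with h | h
    · have := Fintype.card_pos (α := F); rw [hq, h] at this; simp at this
    · exact h
  have hq1' : (1 : ℝ) ≤ q := by exact_mod_cast hq1
  set z : ℝ := 1 / (q : ℝ) ^ μ with hz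
  have hz0 : 0 ≤ z := by positivity
  have hμ : ∀ i, i ≠ i₀ → μ ≤ Module.finrank F (blockIdeal e {i}) := fun i hi =>
    minIdempotentDim_le he fun h => hi (by
      by_contra hne
      have := he.mul_of_ne hne
      rw [h, hi₀, (isIdempotentElem_trivialIdempotent hn).eq] at this
      exact trivialIdempotent_ne_zero hn this)
  -- the elements which give a singular `1 + b b̄`
  let X : Fin m → Finset (MonoidAlgebra F G) := fun i =>
    Finset.univ.filter (fun b => e i * (1 + b * barHom G σ b) = 0)
  have hX : ∀ i, i ≠ i₀ → ((X i).card : ℝ) ≤ 2 * A * z := by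
    intro i hi
    have hunit : IsUnit (barHom G σ (MonoidAlgebra.single 1 θ) - MonoidAlgebra.single 1 θ) := by
      rw [barHom_single, inv_one]
      refine IsUnit.of_mul_eq_one (MonoidAlgebra.single 1 (σ θ - θ)⁻¹) ?_
      rw [sub_mul, MonoidAlgebra.single_mul_single, MonoidAlgebra.single_mul_single, mul_one,
        MonoidAlgebra.one_def]
      ext g
      by_cases hg : (1 : G) = g
      · simp [← hg, ← sub_mul, sub_ne_zero.2 hθ]
      · simp [hg]
    have h1 := he.card_nonunit_le (barHom G σ) (barHom_barHom hσ) _ hunit i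
    rw [natCard_ideal hq, ← mul_pow, show 4 * Fintype.card (MonoidAlgebra F G) ^ 2
      = (2 * A) ^ 2 by ring] at h1
    have h2 := (Nat.pow_le_pow_iff_left two_ne_zero).1 h1
    have h3 : (X i).card * q ^ μ ≤ 2 * A :=
      (Nat.mul_le_mul_left _ (Nat.pow_le_pow_right hq1 (hμ i hi))).trans h2
    rw [hz, mul_one_div, le_div_iff₀ (by positivity)]
    exact_mod_cast h3
  -- the elements which give low weight codewords
  let Y := lowWeightMultipliers e δ
  -- Only blocks other than the trivial one have dimension at least `μ`, so the bound is expressed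
  -- through a set `T` avoiding `i₀`.
  have hY : ∀ S T : Finset (Fin m), T ⊆ S → i₀ ∉ T → ((Y S).card : ℝ) ≤ n ^ 2 * A * z ^ T.card := by
    intro S T hTS hT
    have h1 := card_lowWeightMultipliers_le hq he ht0 ht1 hc hcq S
    have h2 : μ * T.card ≤ Module.finrank F (blockIdeal e S) := by
      have h3 := he.prod_card_le S
      simp only [natCard_ideal hq, Finset.prod_pow] at h3
      have h4 := (Nat.pow_le_pow_iff_left two_ne_zero).1 h3
      rw [Finset.prod_pow_eq_pow_sum] at h4
      by_cases hq2 : q = 1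
      · rw [hq2] at hq
        have := Fintype.one_lt_card (α := F)
        omega
      · have h5 := (Nat.pow_le_pow_iff_right (by omega)).1 h4
        refine le_trans ?_ h5
        calc μ * T.card = ∑ i ∈ T, μ := by simp [mul_comm]
          _ ≤ ∑ i ∈ T, Module.finrank F (blockIdeal e {i}) :=
            Finset.sum_le_sum fun i hi => hμ i fun h => hT (h ▸ hi)
          _ ≤ _ := Finset.sum_le_sum_of_subset hTS
    rw [hz, div_pow, one_pow, mul_one_div, le_div_iff₀ (by positivity), ← pow_mul]
    refine le_trans ?_ h1
    gcongr
  by_contra! hcon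
  -- On the trivial block `1 + b * bar b` is then 1. The count of `card_nonunit_le` is too weak on a
  -- block of dimension 1, and this restriction costs only a factor `q²`.
  set B := Finset.univ.filter (fun b : MonoidAlgebra F G => trivialIdempotent F G * b = 0) with hB
  have hBcard : (A : ℝ) ≤ B.card * q ^ 2 := by
    have := card_le_card_annihilator_mul (G := G) hn
    rw [hq] at this
    exact_mod_cast this
  have hcover : B ⊆ ((Finset.univ.erase i₀).biUnion X) ∪
      (((Finset.univ.erase i₀).powerset.erase ∅).biUnion fun T => Y T ∪ Y (insert i₀ T)) := by
    intro b hb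
    have hb0 : e i₀ * b = 0 := by rw [hi₀]; exact (Finset.mem_filter.1 hb).2
    rw [Finset.mem_union]
    by_cases hu : IsUnit (1 + b * barHom G σ b)
    · right
      obtain ⟨a, ha0, haw⟩ := hcon b hu
      let S := Finset.univ.filter (fun i => e i * a ≠ 0)
      have hbS : b ∈ Y S := by
        refine mem_lowWeightMultipliers.2 ⟨a, by simp [S], ?_, ?_⟩
        · have : (0 : ℝ) ≤ ((a * b).coeff.support.card : ℝ) := by positivity
          linarith
        · have : (0 : ℝ) ≤ (a.coeff.support.card : ℝ) := by positivity
          linarith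
      -- Otherwise `a` lies in the trivial block and has full weight, contradicting `δ < 1`.
      have hSne : S.erase i₀ ≠ ∅ := by
        intro hS
        have h1 : trivialIdempotent F G * a = a := by
          conv_rhs => rw [← he.sum_mul a]
          rw [Finset.sum_eq_single i₀, hi₀]
          · intro j _ hj
            by_contra h2
            have : j ∈ S.erase i₀ := Finset.mem_erase.2 ⟨hj, by simpa [S] using h2⟩
            rw [hS] at this
            simp at this
          · simp
        have h2 := card_support_of_trivialIdempotent_mul hn ha0 h1
        rw [h2] at haw
        have hnpos : (0 : ℝ) < n := by
          have : 0 < n := Fintype.card_pos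
          exact_mod_cast this
        have : (0 : ℝ) ≤ ((a * b).coeff.support.card : ℝ) := by positivity
        nlinarith
      rw [Finset.mem_biUnion]
      refine ⟨S.erase i₀, ?_, ?_⟩
      · rw [Finset.mem_erase, Finset.mem_powerset]
        exact ⟨hSne, Finset.erase_subset_erase _ (Finset.subset_univ _)⟩
      · rw [Finset.mem_union]
        by_cases hS : i₀ ∈ S
        · right; rwa [Finset.insert_erase hS]
        · left; rwa [Finset.erase_eq_of_notMem hS]
    · left
      obtain ⟨i, hi⟩ : ∃ i, e i * (1 + b * barHom G σ b) = 0 := by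
        by_contra! h
        exact hu (he.isUnit h)
      rw [Finset.mem_biUnion]
      refine ⟨i, ?_, by simpa [X] using hi⟩
      rw [Finset.mem_erase]
      refine ⟨?_, Finset.mem_univ _⟩
      rintro rfl
      rw [mul_add, mul_one, ← mul_assoc, hb0, zero_mul, add_zero] at hi
      exact he.ne_zero _ hi
  have h1 : (((Finset.univ.erase i₀).biUnion X).card : ℝ) ≤ A * (2 * n * z) := by
    calc (((Finset.univ.erase i₀).biUnion X).card : ℝ)
        ≤ ∑ i ∈ Finset.univ.erase i₀, ((X i).card : ℝ) := by
          exact_mod_cast Finset.card_biUnion_le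
      _ ≤ ∑ i ∈ Finset.univ.erase i₀, 2 * A * z :=
          Finset.sum_le_sum fun i hi => hX i (Finset.ne_of_mem_erase hi)
      _ ≤ ∑ i : Fin m, 2 * A * z :=
          Finset.sum_le_sum_of_subset_of_nonneg (Finset.erase_subset _ _)
            fun _ _ _ => by positivity
      _ = m * (2 * A * z) := by simp
      _ ≤ n * (2 * A * z) := by gcongr
      _ = _ := by ring
  have h2 : ((((Finset.univ.erase i₀).powerset.erase ∅).biUnion
      fun T => Y T ∪ Y (insert i₀ T)).card : ℝ) ≤ A * (2 * n ^ 2 * ((1 + z) ^ n - 1)) := by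
    calc ((((Finset.univ.erase i₀).powerset.erase ∅).biUnion
          fun T => Y T ∪ Y (insert i₀ T)).card : ℝ)
        ≤ ∑ T ∈ (Finset.univ.erase i₀).powerset.erase ∅,
            ((Y T ∪ Y (insert i₀ T)).card : ℝ) := by
          exact_mod_cast Finset.card_biUnion_le
      _ ≤ ∑ T ∈ (Finset.univ.erase i₀).powerset.erase ∅, 2 * n ^ 2 * A * z ^ T.card := by
          refine Finset.sum_le_sum fun T hT => ?_
          have hT' : i₀ ∉ T := fun h => by
            have := Finset.mem_powerset.1 (Finset.mem_of_mem_erase hT) h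
            simp at this
          have h3 : ((Y T ∪ Y (insert i₀ T)).card : ℝ) ≤ (Y T).card + (Y (insert i₀ T)).card := by
            exact_mod_cast Finset.card_union_le _ _
          have h4 := hY T T subset_rfl hT'
          have h5 := hY (insert i₀ T) T (Finset.subset_insert _ _) hT'
          linarith
      -- Binomial theorem over the subsets of the `m - 1` nontrivial blocks; the empty set accounts
      -- for the `- 1`.
      _ = 2 * n ^ 2 * A * ((1 + z) ^ (m - 1) - 1) := by
          rw [← Finset.mul_sum, Finset.sum_erase_eq_sub (Finset.empty_mem_powerset _)]
          have := Finset.sum_pow_mul_eq_add_pow z 1 (Finset.univ.erase i₀)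
          simp only [one_pow, mul_one] at this
          rw [this, Finset.card_erase_of_mem (Finset.mem_univ _), Finset.card_univ,
            Fintype.card_fin, Finset.card_empty, pow_zero, add_comm z 1]
      _ ≤ 2 * n ^ 2 * A * ((1 + z) ^ n - 1) := by
          have : (1 + z) ^ (m - 1) ≤ (1 + z) ^ n :=
            pow_le_pow_right₀ (by linarith) (by omega)
          gcongr
      _ = _ := by ring
  have h3 : (B.card : ℝ) ≤ A * (2 * n * z + 2 * n ^ 2 * ((1 + z) ^ n - 1)) := by
    have := (Finset.card_le_card hcover).trans (Finset.card_union_le _ _)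
    have h4 : (B.card : ℝ) ≤ ((Finset.univ.erase i₀).biUnion X).card +
        (((Finset.univ.erase i₀).powerset.erase ∅).biUnion
          fun T => Y T ∪ Y (insert i₀ T)).card := by exact_mod_cast this
    linarith
  have hq2 : (0 : ℝ) < (q : ℝ) ^ 2 := by positivity
  have h4 : (B.card : ℝ) < A * (1 / (q : ℝ) ^ 2) :=
    h3.trans_lt (mul_lt_mul_of_pos_left hsmall hApos)
  rw [mul_one_div, lt_div_iff₀ hq2] at h4
  linarith

end RandomChoice

/-! ### From the chain ring to its residue field -/

section Lift

open MonoidAlgebra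

variable {S G : Type*} [CommRing S] [IsLocalRing S] [CommGroup G]

/-- Reduction of the coefficients modulo the maximal ideal. -/
noncomputable def reduction (S G : Type*) [CommRing S] [IsLocalRing S] [CommGroup G] :
    MonoidAlgebra S G →+* MonoidAlgebra (IsLocalRing.ResidueField S) G :=
  mapRingHom G (IsLocalRing.residue S)

theorem coeff_reduction (x : MonoidAlgebra S G) (g : G) :
    (reduction S G x).coeff g = IsLocalRing.residue S (x.coeff g) :=
  coeff_mapRingHom _ _ _

/-- As `w` kills exactly the maximal ideal, a coefficient of `a'` that is nonzero modulo it makes `w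
a' = r a`, hence `a`, nonzero there. -/
theorem card_support_reduction_le {r w : S} {a a' : MonoidAlgebra S G} (h : r • a = w • a')
    (hw : ∀ x, w * x = 0 ↔ IsLocalRing.residue S x = 0) :
    (reduction S G a').coeff.support.card ≤ a.coeff.support.card := by
  refine Finset.card_le_card fun g hg => ?_
  rw [Finsupp.mem_support_iff, coeff_reduction] at hg
  rw [Finsupp.mem_support_iff]
  intro h0
  apply hg
  rw [← hw]
  have := congrArg (fun x => x.coeff g) h
  simp only [coeff_smul_apply, smul_eq_mul, h0, mul_zero] at this
  exact this.symm

variable [Fintype G]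

theorem reduction_surjective : Function.Surjective (reduction S G) := by
  intro y
  choose s hs using fun g => IsLocalRing.residue_surjective (y.coeff g)
  exact ⟨ofCoeff (Finsupp.equivFunOnFinite.symm s), by ext g; simp [coeff_reduction, hs]⟩

theorem isNilpotent_maximalIdeal (S : Type*) [CommRing S] [IsLocalRing S] [Finite S] :
    IsNilpotent (IsLocalRing.maximalIdeal S) := by
  rw [← IsLocalRing.jacobson_eq_maximalIdeal ⊥ bot_ne_top]
  exact IsArtinianRing.isNilpotent_jacobson_bot

/-- Over a finite chain ring, every nonzero `a` has a multiple of the form `w a'` where `w` spans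
the socle and `a'` is nonzero modulo the maximal ideal. -/
theorem exists_smul_eq_socle_smul [Finite S] (hS : IsCommChainRing S) {a : MonoidAlgebra S G}
    (ha : a ≠ 0) : ∃ (r w : S) (a' : MonoidAlgebra S G), r • a = w • a' ∧
      (∀ x, w * x = 0 ↔ IsLocalRing.residue S x = 0) ∧ reduction S G a' ≠ 0 := by
  classical
  set m := IsLocalRing.maximalIdeal S with hm
  -- `r` is taken in the last power of `m` that does not annihilate `a`.
  obtain ⟨r, hra, hmr⟩ : ∃ r : S, r • a ≠ 0 ∧ ∀ y ∈ m, (y * r) • a = 0 := by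
    have hex : ∃ k, ∀ x ∈ m ^ k, x • a = 0 := by
      obtain ⟨k, hk⟩ := isNilpotent_maximalIdeal S
      refine ⟨k, fun x hx => ?_⟩
      rw [hk] at hx
      rw [show x = 0 from hx, zero_smul]
    have hk := Nat.find_spec hex
    have hmin := fun j => Nat.find_min hex (m := j)
    cases hkk : Nat.find hex with
    | zero =>
      rw [hkk] at hk
      exact absurd (by simpa using hk 1 (by simp)) ha
    | succ k =>
      have := hmin k (by omega)
      push Not at this
      obtain ⟨r, hr, hra⟩ := this
      refine ⟨r, hra, fun y hy => hk _ ?_⟩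
      rw [hkk, pow_succ']
      exact Ideal.mul_mem_mul hy hr
  obtain ⟨g₀, hg₀⟩ : ∃ g, (r • a).coeff g ≠ 0 := by
    by_contra! h
    exact hra (by ext g; exact h g)
  have hkill : ∀ g, ∀ y ∈ m, (r • a).coeff g * y = 0 := by
    intro g y hy
    have := congrArg (fun x => x.coeff g) (hmr y hy)
    simp only [coeff_smul_apply, smul_eq_mul, coeff_zero, Finsupp.coe_zero, Pi.zero_apply] at this ⊢
    rw [← this]; ring
  set w := (r • a).coeff g₀
  have hwx : ∀ x, w * x = 0 ↔ IsLocalRing.residue S x = 0 := by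
    intro x
    rw [IsLocalRing.residue_eq_zero_iff]
    refine ⟨fun h => ?_, hkill g₀ x⟩
    by_contra hx
    have hu : IsUnit x := by simpa using hx
    exact hg₀ (hu.mul_left_eq_zero.1 h)
  -- All coefficients of `r • a` are killed by `m`. In a chain ring one of two such elements divides
  -- the other, and if the quotient goes the wrong way it is a unit because `w ≠ 0`.
  have hdvd : ∀ g, ∃ s, (r • a).coeff g = w * s := by
    intro g
    rcases hS.2 (Ideal.span {(r • a).coeff g}) (Ideal.span {w}) with h | h
    · exact Ideal.mem_span_singleton.1 (h (Ideal.mem_span_singleton_self _))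
    · obtain ⟨c, hc⟩ := Ideal.mem_span_singleton.1 (h (Ideal.mem_span_singleton_self _))
      have hu : IsUnit c := by
        by_contra hcu
        apply hg₀
        rw [hc]
        exact hkill g c (by simpa [hm] using hcu)
      obtain ⟨u, rfl⟩ := hu
      exact ⟨↑u⁻¹, by rw [hc, mul_assoc, Units.mul_inv, mul_one]⟩
  choose s hs using hdvd
  refine ⟨r, w, ofCoeff (Finsupp.equivFunOnFinite.symm s), ?_, hwx, ?_⟩
  · ext g
    rw [hs g]
    simp
  · intro h
    apply hg₀
    have := congrArg (fun x => x.coeff g₀) h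
    simp only [coeff_reduction] at this
    exact (hs g₀).trans ((hwx _).2 (by simpa using this))

end Lift

/-! ### The codes of pairs `(a, ab)` -/

section Code

open MonoidAlgebra

variable {S G : Type*} [CommRing S] [CommGroup G]

/-- The `SG`-linear map `a ↦ (a, ab)`. -/
noncomputable def doubleCirculantMap (b : MonoidAlgebra S G) :
    MonoidAlgebra S G →ₗ[MonoidAlgebra S G] MonoidAlgebra S G × MonoidAlgebra S G :=
  LinearMap.toSpanSingleton _ _ (1, b)

/-- The code `{(a, ab)}`. -/
noncomputable def doubleCirculantCode (b : MonoidAlgebra S G) : TwoQuasiAbelianCode S G :=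
  LinearMap.range (doubleCirculantMap b)

theorem doubleCirculantMap_apply (b a : MonoidAlgebra S G) :
    doubleCirculantMap b a = (a, a * b) := by
  simp [doubleCirculantMap]

theorem mem_doubleCirculantCode {b : MonoidAlgebra S G}
    {x : MonoidAlgebra S G × MonoidAlgebra S G} :
    x ∈ doubleCirculantCode b ↔ ∃ a, (a, a * b) = x := by
  simp [doubleCirculantCode, doubleCirculantMap_apply]

/-- The code `{(a, ab)}` is free of rank `|G|`. -/
noncomputable def doubleCirculantEquiv (b : MonoidAlgebra S G) :
    (G →₀ S) ≃ₗ[S] doubleCirculantCode b :=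
  (coeffLinearEquiv S).symm.trans
  ((LinearEquiv.ofInjective (doubleCirculantMap b) (fun x y h => by
    simp only [doubleCirculantMap_apply, Prod.mk.injEq] at h
    exact h.1)).restrictScalars S)

theorem free_doubleCirculantCode (b : MonoidAlgebra S G) :
    Module.Free S (doubleCirculantCode b) :=
  Module.Free.of_equiv (doubleCirculantEquiv b)

theorem reduction_barHom [IsLocalRing S] {R : Type*} [CommRing R] [Algebra R S] (σ : S ≃ₐ[R] S)
    [IsLocalHom (σ : S →+* S)] (x : MonoidAlgebra S G) :
    reduction S G (barHom G (σ : S →+* S) x) =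
      barHom G (IsLocalRing.ResidueField.map (σ : S →+* S)) (reduction S G x) := by
  ext g
  simp [coeff_reduction, coeff_barHom]

variable [Fintype G]

theorem codeRate_doubleCirculantCode [Nontrivial S] (b : MonoidAlgebra S G) :
    codeRate (doubleCirculantCode b) = 1 / 2 := by
  have h : Module.finrank S (doubleCirculantCode b) = Fintype.card G := by
    rw [← (doubleCirculantEquiv b).finrank_eq, Module.finrank_finsupp_self]
  have hpos : (0 : ℝ) < Fintype.card G := by exact_mod_cast Fintype.card_pos
  rw [codeRate, h, codeLength]
  push_cast
  field_simp

theorem hermitianInner_eq_coeff {R : Type*} [CommRing R] [Algebra R S] (σ : S ≃ₐ[R] S)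
    (x y : MonoidAlgebra S G) :
    hermitianInner σ x y = (x * barHom G (σ : S →+* S) y).coeff 1 := by
  classical
  rw [coeff_mul_antidiag _ _ _ (Finset.univ.image fun g : G => (g, g⁻¹))]
  · rw [Finset.sum_image (fun g _ h _ hgh => congrArg Prod.fst hgh)]
    simp [hermitianInner, coeff_barHom]
  · rintro ⟨g, h⟩
    simp [eq_comm, mul_eq_one_iff_inv_eq]

/-- Pairing `(a, ab)` with `(g, gb)` reads off the coefficient of `a (1 + b * bar b)` at `g`, so a
self-orthogonal `a` satisfies `a (1 + b * bar b) = 0`. The socle multiple `w a'` of `a` turns this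
into the same relation for the nonzero reduction of `a'`, against a unit. -/
theorem isHermitianLCD_doubleCirculantCode [IsLocalRing S] [Finite S] (hS : IsCommChainRing S)
    {R : Type*} [CommRing R] [Algebra R S] (σ : S ≃ₐ[R] S) [IsLocalHom (σ : S →+* S)]
    {b : MonoidAlgebra S G}
    (hb : IsUnit (1 + reduction S G b *
      barHom G (IsLocalRing.ResidueField.map (σ : S →+* S)) (reduction S G b))) :
    IsHermitianLCD σ (doubleCirculantCode b) := by
  refine Set.Subset.antisymm ?_ ?_
  · rintro x ⟨hx, hdual⟩
    obtain ⟨a, rfl⟩ := mem_doubleCirculantCode.1 hx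
    set u := 1 + b * barHom G (σ : S →+* S) b with hu
    have hau : a * u = 0 := by
      ext g
      have h := hdual _ (mem_doubleCirculantCode.2 ⟨single g 1, rfl⟩)
      simp only [hermitianInnerPair, hermitianInner_eq_coeff, map_mul] at h
      rw [← Finsupp.add_apply, ← coeff_add] at h
      have h2 : a * barHom G (σ : S →+* S) (single g 1) +
          a * b * (barHom G (σ : S →+* S) (single g 1) * barHom G (σ : S →+* S) b)
          = barHom G (σ : S →+* S) (single g 1) * (a * u) := by rw [hu]; ring
      rw [h2, barHom_single, map_one (σ : S →+* S), coeff_translate] at h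
      simpa using h
    by_contra hne
    have ha : a ≠ 0 := by
      rintro rfl
      exact hne (by simp)
    obtain ⟨r, w, a', hraw, hw, ha'⟩ := exists_smul_eq_socle_smul hS ha
    apply ha'
    have h0 : w • (a' * u) = 0 := by
      rw [← smul_mul_assoc, ← hraw, smul_mul_assoc, hau, smul_zero]
    have h1 : reduction S G (a' * u) = 0 := by
      ext g
      rw [coeff_reduction]
      have := congrArg (fun x => x.coeff g) h0
      exact (hw _).1 this
    rw [map_mul, hu, map_add, map_one, map_mul, reduction_barHom] at h1
    exact hb.mul_left_eq_zero.1 h1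
  · rintro _ rfl
    refine ⟨zero_mem _, fun c _ => ?_⟩
    simp [hermitianInnerPair, hermitianInner]

theorem lt_minWeight_doubleCirculantCode [IsLocalRing S] [Finite S] (hS : IsCommChainRing S)
    {b : MonoidAlgebra S G} {K : ℝ}
    (h : ∀ a : MonoidAlgebra (IsLocalRing.ResidueField S) G, a ≠ 0 →
      K < a.coeff.support.card + (a * reduction S G b).coeff.support.card) :
    K < minWeight (doubleCirculantCode b) := by
  obtain ⟨x, hxC, hx0, hx⟩ := Nat.sInf_mem (s := {w : ℕ | ∃ x ∈ doubleCirculantCode b,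
    x ≠ 0 ∧ w = pairWeight x}) ⟨_, (1, 1 * b), mem_doubleCirculantCode.2 ⟨1, rfl⟩,
      fun h => one_ne_zero (congrArg Prod.fst h), rfl⟩
  rw [minWeight, hx]
  obtain ⟨a, rfl⟩ := mem_doubleCirculantCode.1 hxC
  have ha : a ≠ 0 := by
    rintro rfl
    exact hx0 (by simp)
  obtain ⟨r, w, a', hraw, hw, ha'⟩ := exists_smul_eq_socle_smul hS ha
  refine (h _ ha').trans_le ?_
  have h1 := card_support_reduction_le hraw hw
  have hraw' : r • (a * b) = w • (a' * b) := by
    rw [← smul_mul_assoc, hraw, smul_mul_assoc]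
  have h2 := card_support_reduction_le hraw' hw
  rw [map_mul] at h2
  unfold pairWeight
  exact_mod_cast Nat.add_le_add h1 h2

end Code

/-! ### The automorphism on the residue field -/

section ResidueAutomorphism

variable {R S : Type*} [CommRing R] [IsLocalRing R] [Finite R] [CommRing S] [IsLocalRing S]
  [Algebra R S]

theorem isLocalHom_algebraMap_of_finite : IsLocalHom (algebraMap R S) := by
  refine ⟨fun a ha => ?_⟩
  by_contra hna
  have hmem : a ∈ IsLocalRing.maximalIdeal R := hna
  obtain ⟨k, hk⟩ := isNilpotent_maximalIdeal R
  have h0 : a ^ k = 0 := by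
    have := Ideal.pow_mem_pow hmem k
    rwa [hk] at this
  have h1 := ha.pow k
  rw [← map_pow, h0, map_zero] at h1
  exact not_isUnit_zero h1

/-- A nontrivial automorphism of a Galois extension of a finite local ring acts nontrivially on
the residue field. -/
theorem exists_residueField_map_ne {d : ℕ} (hRS : IsChainGaloisExtension d R S) (σ : S ≃ₐ[R] S)
    (hσ : σ ≠ 1) [IsLocalHom (σ : S →+* S)] :
    ∃ θ, IsLocalRing.ResidueField.map (σ : S →+* S) θ ≠ θ := by
  obtain ⟨f, -, -, hirr, ⟨ψ⟩⟩ := hRS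
  have : IsLocalHom (algebraMap R S) := isLocalHom_algebraMap_of_finite
  have : Finite (IsLocalRing.ResidueField R) :=
    Finite.of_surjective _ (IsLocalRing.residue_surjective (R := R))
  by_contra! hfix
  apply hσ
  set θ := ψ.symm (AdjoinRoot.root f) with hθ
  have hroot : f.eval₂ (algebraMap R S) θ = 0 := by
    rw [← Polynomial.aeval_def, hθ]
    change Polynomial.aeval ((ψ.symm : AdjoinRoot f →ₐ[R] S) (AdjoinRoot.root f)) f = 0
    rw [Polynomial.aeval_algHom_apply, AdjoinRoot.aeval_eq, AdjoinRoot.mk_self, map_zero]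
  have hroot' : f.eval₂ (algebraMap R S) (σ θ) = 0 := by
    rw [← Polynomial.aeval_def] at hroot ⊢
    change Polynomial.aeval ((σ : S →ₐ[R] S) θ) f = 0
    rw [Polynomial.aeval_algHom_apply, hroot, map_zero]
  have hcomp : (IsLocalRing.ResidueField.map (algebraMap R S)).comp (IsLocalRing.residue R)
      = (IsLocalRing.residue S).comp (algebraMap R S) := by ext; simp
  -- The reduction of `f` is irreducible over a finite, hence perfect, field, so its roots are
  -- simple.
  have hder : IsUnit ((Polynomial.derivative f).eval₂ (algebraMap R S) θ) := by
    have h1 := (PerfectField.separable_of_irreducible hirr).eval₂_derivative_ne_zero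
      (IsLocalRing.ResidueField.map (algebraMap R S)) (x := IsLocalRing.residue S θ) (by
        rw [Polynomial.eval₂_map, hcomp, ← Polynomial.hom_eval₂, hroot, map_zero])
    rw [Polynomial.derivative_map, Polynomial.eval₂_map, hcomp, ← Polynomial.hom_eval₂] at h1
    exact (IsLocalRing.residue_ne_zero_iff_isUnit _).1 h1
  have hε : σ θ - θ ∈ IsLocalRing.maximalIdeal S := by
    rw [← IsLocalRing.residue_eq_zero_iff, map_sub, sub_eq_zero, ← hfix (IsLocalRing.residue S θ)]
    rfl
  -- With `ε = σ θ - θ` in the maximal ideal, Taylor expansion gives `0 = ε (f'(θ) + k ε)`; the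
  -- second factor is a unit, so `ε = 0`.
  obtain ⟨k, hk⟩ := Polynomial.binomExpansion (f.map (algebraMap R S)) θ (σ θ - θ)
  rw [add_sub_cancel, Polynomial.derivative_map, Polynomial.eval_map, Polynomial.eval_map,
    Polynomial.eval_map, hroot, hroot'] at hk
  have hu : IsUnit ((Polynomial.derivative f).eval₂ (algebraMap R S) θ + k * (σ θ - θ)) := by
    by_contra hcon
    have hmem : (Polynomial.derivative f).eval₂ (algebraMap R S) θ + k * (σ θ - θ) ∈
      IsLocalRing.maximalIdeal S := hcon
    exact ((Submodule.add_mem_iff_left _ (Ideal.mul_mem_left _ k hε)).1 hmem) hder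
  have hfixθ : σ θ = θ := by
    rw [← sub_eq_zero, ← hu.mul_right_eq_zero]
    linear_combination -hk
  have hhom : (σ : S →ₐ[R] S).comp (ψ.symm : AdjoinRoot f →ₐ[R] S)
      = (ψ.symm : AdjoinRoot f →ₐ[R] S) := AdjoinRoot.algHom_ext hfixθ
  ext x
  have := congrArg (fun h : AdjoinRoot f →ₐ[R] S => h (ψ x)) hhom
  simpa using this

end ResidueAutomorphism

/-! ### Asymptotic estimates -/

section Asymptotics

/-- With `z = 1/q^μ`, the bound `(1 + z)^n - 1 ≤ 2nz` makes the left side at most `2nz + 4n³z ≤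
6n³z`. As `z n^6 ≤ 1`, this is at most `6/n`, which is below `1/q²`. -/
theorem bad_fraction_lt {q : ℝ} (hq : 1 ≤ q) {n μ : ℕ} (hn : 6 * q ^ 2 < n)
    (hμ : (n : ℝ) ^ 6 < q ^ μ) :
    2 * n * (1 / q ^ μ) + 2 * (n : ℝ) ^ 2 * ((1 + 1 / q ^ μ) ^ n - 1) < 1 / q ^ 2 := by
  have hn1 : (1 : ℝ) ≤ n := by nlinarith
  set x : ℝ := (n : ℝ) with hx
  set z : ℝ := 1 / q ^ μ with hz
  have hz0 : 0 ≤ z := by positivity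
  have hz1 : z * x ^ 6 ≤ 1 := by
    rw [hz, one_div_mul_eq_div, div_le_one (by positivity)]
    exact hμ.le
  have hx3 : z * x ^ 3 * x ≤ 1 := by
    refine le_trans ?_ hz1
    have : x ^ 4 ≤ x ^ 6 := pow_le_pow_right₀ hn1 (by norm_num)
    calc z * x ^ 3 * x = z * x ^ 4 := by ring
      _ ≤ _ := by gcongr
  have h1 : x * z ≤ z * x ^ 3 := by
    have : x ^ 1 ≤ x ^ 3 := pow_le_pow_right₀ hn1 (by norm_num)
    calc x * z = z * x ^ 1 := by ring
      _ ≤ _ := by gcongr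
  have h2 : z * x ^ 3 ≤ z * x ^ 3 * x := le_mul_of_one_le_right (by positivity) hn1
  have h3 : (1 + z) ^ n - 1 ≤ 2 * (x * z) := by
    have h4 : (1 + z) ^ n ≤ Real.exp (x * z) := by
      rw [hx, Real.exp_nat_mul]
      gcongr
      linarith [Real.add_one_le_exp z]
    have h5 := Real.abs_exp_sub_one_le (x := x * z) (by
      rw [abs_of_nonneg (by positivity)]; linarith)
    rw [abs_of_nonneg (by positivity : 0 ≤ x * z)] at h5
    linarith [le_abs_self (Real.exp (x * z) - 1)]
  have h6 : 2 * x * z + 2 * x ^ 2 * ((1 + z) ^ n - 1) ≤ 6 * (z * x ^ 3) := by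
    have : 2 * x ^ 2 * ((1 + z) ^ n - 1) ≤ 2 * x ^ 2 * (2 * (x * z)) := by gcongr
    nlinarith
  refine h6.trans_lt ?_
  rw [lt_div_iff₀ (by positivity)]
  have h7 : 0 ≤ z * x ^ 3 := by positivity
  nlinarith

/-- If `log n / μ → 0` with `1 ≤ μ ≤ n`, then `n → ∞`. -/
theorem tendsto_atTop_of_logb_div {q : ℝ} (hq : 1 < q) {n μ : ℕ → ℕ} (hn : ∀ i, 1 < n i)
    (hμ0 : ∀ i, 0 < μ i) (hμ : ∀ i, μ i ≤ n i)
    (hlim : Tendsto (fun i => Real.logb q (n i) / (μ i : ℝ)) atTop (𝓝 0)) :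
    Tendsto n atTop atTop := by
  rw [tendsto_atTop]
  intro M
  have h2 : 0 < Real.logb q 2 := Real.logb_pos hq (by norm_num)
  -- Since `n ≥ 2` and `μ ≤ n`, the quotient is at least `log 2 / n`; falling below this threshold
  -- forces `n > M + 1`.
  have hε : 0 < Real.logb q 2 / (M + 1) := by positivity
  filter_upwards [hlim.eventually_lt_const hε] with i hi
  have hn2 : (2 : ℝ) ≤ n i := by exact_mod_cast hn i
  have h3 : Real.logb q 2 / n i ≤ Real.logb q (n i) / (μ i : ℝ) := by
    have : Real.logb q 2 ≤ Real.logb q (n i) := Real.logb_le_logb_of_le hq (by norm_num) hn2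
    have hm : (μ i : ℝ) ≤ n i := by exact_mod_cast hμ i
    have hm0 : (0 : ℝ) < μ i := by exact_mod_cast hμ0 i
    gcongr
    linarith
  have h4 := h3.trans_lt hi
  rw [div_lt_div_iff_of_pos_left h2 (by linarith) (by positivity)] at h4
  have : M + 1 < n i := by exact_mod_cast h4
  omega

theorem pow_six_lt_of_logb_div {q : ℝ} (hq : 1 < q) {n μ : ℕ} (hn : 0 < n) (hμ : 0 < μ)
    (h : Real.logb q n / (μ : ℝ) < 1 / 6) : (n : ℝ) ^ 6 < q ^ μ := by
  have hμ' : (0 : ℝ) < μ := by exact_mod_cast hμ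
  have hn' : (0 : ℝ) < n := by exact_mod_cast hn
  rw [div_lt_iff₀ hμ'] at h
  rw [← Real.rpow_natCast q μ, ← Real.logb_lt_iff_lt_rpow hq (by positivity), Real.logb_pow]
  push_cast
  linarith

end Asymptotics

/-! ### Assembling the sequence of codes -/

section Sequence

theorem natCast_ne_zero_of_coprime {F : Type*} [Field F] [Fintype F] {n q : ℕ}
    (hq : Fintype.card F = q ^ 2) (h : Nat.Coprime n q) : (n : F) ≠ 0 := by
  intro hn
  have hq0 : (q : F) = 0 := by
    have := FiniteField.cast_card_eq_zero F
    rw [hq] at this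
    push_cast at this
    exact pow_eq_zero_iff two_ne_zero |>.1 this
  obtain ⟨u, v, huv⟩ := Nat.isCoprime_iff_coprime.2 h
  have := congrArg (Int.cast : ℤ → F) huv
  push_cast at this
  rw [hn, hq0] at this
  simp at this

theorem relMinDist_eq {S G : Type*} [CommRing S] [CommGroup G] [Fintype G]
    (C : TwoQuasiAbelianCode S G) : relMinDist C = minWeight C / (2 * Fintype.card G) := by
  simp [relMinDist, codeLength]

end Sequence

theorem theorem4p12 {R S : Type*} [CommRing R] [IsLocalRing R] [Finite R]
    [CommRing S] [IsLocalRing S] [Finite S] [Algebra R S]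
    (hR : IsCommChainRing R) (hS : IsCommChainRing S)
    (hRS : IsChainGaloisExtension 2 R S)
    (σ : S ≃ₐ[R] S) (hσ : orderOf σ = 2)
    (q : ℕ) (hqR : Nat.card (IsLocalRing.ResidueField R) = q)
    (hqS : Nat.card (IsLocalRing.ResidueField S) = q ^ 2)
    (G : ℕ → Type*) [∀ i, CommGroup (G i)] [∀ i, Fintype (G i)]
    (n : ℕ → ℕ) (hG : ∀ i, Fintype.card (G i) = n i)
    (hn : ∀ i, 1 < n i) (hodd : ∀ i, Odd (n i)) (hcop : ∀ i, Nat.Coprime (n i) q)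
    (hlim : Tendsto
      (fun i => Real.logb q (n i) /
        (minIdempotentDim (IsLocalRing.ResidueField S) (G i) : ℝ)) atTop (𝓝 0)) :
    ∃ C : ∀ i, TwoQuasiAbelianCode S (G i),
      (∀ i, IsHermitianLCD σ (C i)) ∧
      IsAsymptoticallyGood C ∧
      (∀ i, Module.Free S (C i) ∧ codeRate (C i) = 1 / 2) := by
  have : Finite (IsLocalRing.ResidueField S) :=
    Finite.of_surjective _ (IsLocalRing.residue_surjective (R := S))
  have := Fintype.ofFinite (IsLocalRing.ResidueField S)
  have hlocal : IsLocalHom (σ : S →+* S) :=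
    ⟨fun a ha => (MulEquiv.isUnit_map σ.toMulEquiv).1 ha⟩
  set F := IsLocalRing.ResidueField S
  have hqF : Fintype.card F = q ^ 2 := by rw [← Nat.card_eq_fintype_card, hqS]
  have hq1 : 1 < q := by
    by_contra hcon
    have h1 := Fintype.one_lt_card (α := F)
    rw [hqF] at h1
    interval_cases q <;> simp at h1
  have hq1' : (1 : ℝ) < q := by exact_mod_cast hq1
  set τ : F →+* F := IsLocalRing.ResidueField.map (σ : S →+* S) with hτdef
  have hτ : ∀ x, τ (τ x) = x := by
    intro x
    obtain ⟨s, rfl⟩ := IsLocalRing.residue_surjective x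
    have h2 : σ * σ = 1 := by rw [← sq, ← hσ, pow_orderOf_eq_one]
    have h3 : σ (σ s) = s := congrArg (fun f : S ≃ₐ[R] S => f s) h2
    rw [hτdef, IsLocalRing.ResidueField.map_residue, IsLocalRing.ResidueField.map_residue]
    exact congrArg _ h3
  obtain ⟨θ, hθ⟩ := exists_residueField_map_ne hRS σ (by rintro rfl; simp at hσ)
  have hcard : ∀ i, (Fintype.card (G i) : F) ≠ 0 := fun i => by
    rw [hG i]
    exact natCast_ne_zero_of_coprime hqF (hcop i)
  set μ : ℕ → ℕ := fun i => minIdempotentDim F (G i) with hμdef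
  have hμ0 : ∀ i, 0 < μ i := fun i => minIdempotentDim_pos (hcard i) (by rw [hG i]; exact hn i)
  have hμn : ∀ i, μ i ≤ n i := fun i => by
    rw [← hG i]
    exact minIdempotentDim_le_card (hcard i) (by rw [hG i]; exact hn i)
  have hninf : Tendsto n atTop atTop := tendsto_atTop_of_logb_div hq1' hn hμ0 hμn hlim
  -- `c = √q` is the largest value allowed by `c² ≤ q`; `t` and `δ` depend only on `q`, so `δ` is
  -- uniform in `i`.
  obtain ⟨t, δ, ht0, ht1, hδ0, hδ1, hc⟩ :=
    exists_balanced_parameters (Fintype.card F) (c := √q) (Real.lt_sqrt_of_sq_lt (by simpa using hq1'))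
  have hev : ∀ᶠ i in atTop, 6 * (q : ℝ) ^ 2 < n i ∧ (n i : ℝ) ^ 6 < (q : ℝ) ^ μ i := by
    have h1 : Tendsto (fun i => (n i : ℝ)) atTop atTop := tendsto_natCast_atTop_atTop.comp hninf
    filter_upwards [h1.eventually_gt_atTop (6 * (q : ℝ) ^ 2),
      hlim.eventually_lt_const (show (0 : ℝ) < 1 / 6 by norm_num)] with i hi hi'
    exact ⟨hi, pow_six_lt_of_logb_div hq1' (by have := hn i; omega) (hμ0 i) hi'⟩
  obtain ⟨i₀, hi₀⟩ := eventually_atTop.1 hev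
  have hb : ∀ i, ∃ b : MonoidAlgebra S (G i),
      IsUnit (1 + reduction S (G i) b * barHom (G i) τ (reduction S (G i) b)) ∧
      (i₀ ≤ i → δ * n i < minWeight (doubleCirculantCode b)) := by
    intro i
    by_cases hi : i₀ ≤ i
    · obtain ⟨b, hbu, hbw⟩ := exists_isUnit_and_weight (G := G i) hqF (hcard i) hτ hθ ht0 ht1 hδ1
        hc (Real.sq_sqrt (Nat.cast_nonneg q)).le (by
          have := bad_fraction_lt hq1'.le (hi₀ i hi).1 (hi₀ i hi).2
          rw [hG i]
          exact this)
      obtain ⟨b, rfl⟩ := reduction_surjective b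
      refine ⟨b, hbu, fun _ => lt_minWeight_doubleCirculantCode hS ?_⟩
      rw [← hG i]
      exact hbw
    -- For the finitely many early indices `b = 0` suffices: the code is LCD, and its minimum weight
    -- is at least 1.
    · exact ⟨0, by simp, fun h => absurd h hi⟩
  choose b hbu hbw using hb
  have hpos : ∀ i, (0 : ℝ) < minWeight (doubleCirculantCode (b i)) := fun i =>
    lt_minWeight_doubleCirculantCode hS fun a ha => by
      have h1 : 0 < a.coeff.support.card := by
        rw [Finset.card_pos, Finsupp.support_nonempty_iff]
        simpa using ha
      positivity
  refine ⟨fun i => doubleCirculantCode (b i),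
    fun i => isHermitianLCD_doubleCirculantCode hS σ (hbu i), ⟨?_, ?_, ?_⟩,
    fun i => ⟨free_doubleCirculantCode _, codeRate_doubleCirculantCode _⟩⟩
  · simp only [codeLength, hG]
    exact hninf.const_mul_atTop' two_pos
  · exact ⟨1 / 2, by norm_num, fun i => (codeRate_doubleCirculantCode _).ge⟩
  -- Early codes have length `2 n i ≤ 2N < 2N + 1` and minimum weight at least 1; the later ones
  -- have relative distance above `δ / 2`.
  · set N : ℕ := ∑ j ∈ Finset.range i₀, n j
    refine ⟨min (δ / 2) (1 / (2 * N + 1)), lt_min (by positivity) (by positivity), fun i => ?_⟩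
    have hni : (0 : ℝ) < n i := by
      have := hn i
      exact_mod_cast (by omega : 0 < n i)
    rw [relMinDist_eq, hG i, lt_div_iff₀ (by positivity)]
    by_cases hi : i₀ ≤ i
    · calc min (δ / 2) (1 / (2 * (N : ℝ) + 1)) * (2 * n i) ≤ δ / 2 * (2 * n i) := by
            gcongr; exact min_le_left _ _
        _ = δ * n i := by ring
        _ < _ := hbw i hi
    · have hle : n i ≤ N := Finset.single_le_sum (f := n) (fun _ _ => Nat.zero_le _)
        (Finset.mem_range.2 (by omega))
      have hle' : (n i : ℝ) ≤ N := by exact_mod_cast hle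
      have h1 : (1 : ℝ) ≤ minWeight (doubleCirculantCode (b i)) := by
        have := hpos i
        have h2 : 0 < minWeight (doubleCirculantCode (b i)) := by exact_mod_cast this
        exact_mod_cast h2
      refine lt_of_lt_of_le ?_ h1
      calc min (δ / 2) (1 / (2 * (N : ℝ) + 1)) * (2 * n i)
          ≤ 1 / (2 * (N : ℝ) + 1) * (2 * n i) := by gcongr; exact min_le_right _ _
        _ < 1 := by
          rw [one_div_mul_eq_div, div_lt_one (by positivity)]
          linarith
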